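/- **Model.** Let $y=X\beta^*+w\in\mathbb R^n$, where $X$ is a fixed $n\times p$ matrix with $\frac1n\sum_i x_{ij}^2=1$ for every $j$, and $\beta^*=(\beta^*_S,0)$ with support $S=\{1,\dots,s\}$, $1\le s\le p$. The covariates are observed as $Z=X+A$. The $w_i$ are identically distributed with mean $0$, and the rows $a_i$ of $A$ are identically distributed with mean $0$ and known covariance matrix $\Sigma_A$; the pairs $(a_i,w_i)$, $i=1,\dots,n$, are independent, and $E(a_{ij}w_i)=0$ for all $i,j$ (for instance $A$ and $w$ are independent). For some $\sigma,\tau>0$, $\Pr(|w_i|>t)\le 2e^{-t^2/2\sigma^2}$ and $\Pr(|v'a_i|>t)\le 2e^{-t^2/2\tau^2}$ for all $t>0$ and all $v$ with $\|v\|_2=1$. **Estimator.** Put $\Sigma=\frac1nX'X$, $\widehat\Sigma=\frac1nZ'Z-\Sigma_A$, $\tilde\rho=\frac1nZ'y$. Let $\widetilde\Sigma$ be a minimizer of $\|\widehat\Sigma-K\|_{\max}$ over the positive semi-definite matrices $K$ (one exists; everything below holds simultaneously for all of them). For $\lambda>0$, a CoCoLasso estimate $\hat\beta$ is a global minimizer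 of $\beta\mapsto\frac12\beta'\widetilde\Sigma\beta-\tilde\rho'\beta+\lambda\|\beta\|_1$. **Notation.** $\|K\|_{\max}=\max_{i,j}|k_{ij}|$, $\|K\|_\infty=\max_i\sum_j|k_{ij}|$, $\Lambda_{\min}$ is the least eigenvalue, $B=\|\beta^*_S\|_\infty$, $\beta^*_{\min}=\min_{j\in S}|\beta^*_j|$, $$\zeta_0=\max(\tau^2,\tau^2B^2,\tau^4,\sigma^4),\quad \zeta_1=\max(\zeta_0,B^2\zeta_0,\sigma^2),\quad \zeta_2=\max(\zeta_0,\sigma^2),$$ $$\Omega=\min_{x\ne0,\ \|x_{S^c}\|_1\le3\|x_S\|_1}\frac{x'\Sigma x}{\|x\|_2^2},\quad \gamma=1-\|\Sigma_{S^c,S}\Sigma_{S,S}^{-1}\|_\infty,\quad C_{\min}=\Lambda_{\min}(\Sigma_{S,S}),\quad \kappa=4\|\Sigma_{S,S}^{-1}\|_\infty+C_{\min}^{-1/2}.$$ **Corollary.** There are universal constants $C,c>0$ such that, with $\epsilon_0=c\tau^2$, parts 1 and 2 hold. 1. (Error bounds.) If $\Omega>0$, $0<\lambda\le\min(\epsilon_0,12\epsilon_0B)$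 and $0<\epsilon\le\min(\epsilon_0,\Omega/(64s))$, then with probability at least $1-p^2C\exp(-cns^{-2}\lambda^2\zeta_1^{-1})-p^2C\exp(-cn\epsilon^2\zeta_1^{-1})$ a CoCoLasso estimate exists and every CoCoLasso estimate satisfies $\|\hat\beta-\beta^*\|_2\le C\lambda\sqrt s/\Omega$ and $\|\hat\beta-\beta^*\|_1\le C\lambda s/\Omega$. 2. (Support recovery.) There are positive $\epsilon_1,\epsilon_2,\epsilon_3$ depending only on $\Sigma_{S,S},\beta^*_S,\gamma,\tau,\sigma$ such that, if $\gamma>0$, $C_{\min}>0$, $0<\lambda\le\min(\epsilon_0,4\epsilon_0/\gamma)$ and $0<\epsilon\le\min(\epsilon_1,\lambda/(\lambda\epsilon_2+\epsilon_3))$, then with probability at least $1-p^2C\exp(-cns^{-2}\gamma^2\lambda^2\zeta_2^{-1})-p^2C\exp(-cns^{-2}\epsilon^2\zeta_2^{-1})$: (a) the CoCoLasso estimate $\hat\beta$ exists, is unique, and its support is contained in $S$; (b) $\|\hat\beta_S-\beta^*_S\|_\infty\le\kappa\lambda$; (c) if $\beta^*_{\min}\ge\kappa\lambda$, then $\operatorname{sign}(\hat\beta_S)=\operatorname{sign}(\beta^*_S)$.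 3. (Sign consistency.) Consider a sequence of such models, all quantities depending on the index, with $\gamma>0$ bounded away from $0$, $C_{\min}>0$, $\tau=O(1)$, $\kappa=O(1)$, $n\to\infty$, $p\to\infty$, $s^2\log p/n\to0$ and $\beta^*_{\min}\gg s(\zeta_2\log p/n)^{1/2}$, and $\lambda>0$ with $\beta^*_{\min}\gg\lambda\gg s(\zeta_2\log p/n)^{1/2}$ (where $a\gg b$ means $b/a\to0$). Then with probability tending to one the CoCoLasso estimate exists, is unique, and satisfies $\operatorname{sign}(\hat\beta)=\operatorname{sign}(\beta^*)$ and $\|\hat\beta_S-\beta^*_S\|_\infty\le\kappa\lambda$. -/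

import Mathlib

open MeasureTheory ProbabilityTheory Filter Topology Asymptotics
open scoped Matrix

noncomputable section

namespace CoCoLasso

/-! Norms of vectors and matrices. The sup norm of a vector `x : ι → ℝ` is Mathlib's `‖x‖`. -/

/-- The norm `‖x‖₁ = ∑ |xᵢ|`. -/
def l1Norm {ι : Type*} [Fintype ι] (x : ι → ℝ) : ℝ := ∑ i, |x i|

/-- The Euclidean norm. -/
def l2Norm {ι : Type*} [Fintype ι] (x : ι → ℝ) : ℝ := Real.sqrt (∑ i, x i ^ 2)

/-- The matrix norm `‖K‖_∞ = maxᵢ ∑ⱼ |Kᵢⱼ|` (which is `0` if there are no rows). -/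
def linftyNorm {m n : Type*} [Fintype n] (K : Matrix m n ℝ) : ℝ := ⨆ i, ∑ j, |K i j|

/-- The elementwise maximum norm `‖K‖_max = maxᵢⱼ |Kᵢⱼ|`. -/
def maxNorm {m n : Type*} (K : Matrix m n ℝ) : ℝ := ⨆ i, ⨆ j, |K i j|

/-- The least eigenvalue of a (symmetric) matrix. -/
def minEigenvalue {m : Type*} [Fintype m] [DecidableEq m] (K : Matrix m m ℝ) : ℝ :=
  sInf (spectrum ℝ K)

/-- `K₁` is a nearest positive semi-definite matrix to `K` for the elementwise maximum norm,
that is, a value of `(K)₊ = argmin_{K₁ ≥ 0} ‖K - K₁‖_max`. -/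
def IsNearestPSD {m : Type*} (K K₁ : Matrix m m ℝ) : Prop :=
  K₁.PosSemidef ∧ ∀ K₂ : Matrix m m ℝ, K₂.PosSemidef → maxNorm (K - K₁) ≤ maxNorm (K - K₂)

/-- The projection `(K)₊` exists, and each of its values has the property `Q`. -/
def ForNearestPSD {m : Type*} (K : Matrix m m ℝ) (Q : Matrix m m ℝ → Prop) : Prop :=
  (∃ K₁, IsNearestPSD K K₁) ∧ ∀ K₁, IsNearestPSD K K₁ → Q K₁

/-- The objective function `½ β'Kβ - ρ'β + lam ‖β‖₁`. -/
def objective {m : Type*} [Fintype m] (K : Matrix m m ℝ) (ρ : m → ℝ) (lam : ℝ) (b : m → ℝ) : ℝ :=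
  1 / 2 * (b ⬝ᵥ K *ᵥ b) - ρ ⬝ᵥ b + lam * l1Norm b

/-- `b` is a global minimizer of the objective function. -/
def IsEstimate {m : Type*} [Fintype m] (K : Matrix m m ℝ) (ρ : m → ℝ) (lam : ℝ) (b : m → ℝ) :
    Prop :=
  ∀ b', objective K ρ lam b ≤ objective K ρ lam b'

/-- `min ‖x‖₂⁻² x'Kx` over all `x ≠ 0` with `‖x_{Sᶜ}‖₁ ≤ 3 ‖x_S‖₁`, where `S` is the first block of
coordinates. -/
def restrictedEigenvalue {s r : ℕ} (K : Matrix (Fin s ⊕ Fin r) (Fin s ⊕ Fin r) ℝ) : ℝ :=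
  sInf ((fun x : Fin s ⊕ Fin r → ℝ => (x ⬝ᵥ K *ᵥ x) / l2Norm x ^ 2) ''
    {x | x ≠ 0 ∧ l1Norm (fun j => x (Sum.inr j)) ≤ 3 * l1Norm (fun j => x (Sum.inl j))})

/-- The property `Q` holds with probability at least `q`. -/
def HoldsWithProb {Ω : Type*} [MeasurableSpace Ω] (P : Measure Ω) (q : ℝ) (Q : Ω → Prop) : Prop :=
  ∃ E : Set Ω, MeasurableSet E ∧ q ≤ P.real E ∧ ∀ ω ∈ E, Q ω

/-- The sub-Gaussian tail bound with parameter `t ^ 2`, for a centred random variable. -/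
def SubGaussianTail {Ω : Type*} [MeasurableSpace Ω] (P : Measure Ω) (U : Ω → ℝ) (t : ℝ) : Prop :=
  ∀ x : ℝ, 0 < x → P.real {ω | x < |U ω|} ≤ 2 * Real.exp (-x ^ 2 / (2 * t ^ 2))

/-- The linear model `y = Xβ* + w` with a fixed design `X` with `n` rows and `p = s + r` columns,
observed through `Z = X + A`. The index set of the covariates is `Fin s ⊕ Fin r`, the first block
being the support `S` of `β*`. -/
structure AdditiveModel (n s r : ℕ) (Ω : Type*) [MeasurableSpace Ω] where
  P : Measure Ω
  isProb : IsProbabilityMeasure P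
  s_pos : 0 < s
  X : Matrix (Fin n) (Fin s ⊕ Fin r) ℝ
  /-- The columns of the design are normalized. -/
  X_norm : ∀ j, 1 / (n : ℝ) * ∑ i, X i j ^ 2 = 1
  /-- The coefficients on the support. -/
  βS : Fin s → ℝ
  βS_ne : ∀ j, βS j ≠ 0
  /-- The noise. -/
  w : Fin n → Ω → ℝ
  /-- The rows of the matrix of measurement errors. -/
  A : Fin n → Ω → (Fin s ⊕ Fin r → ℝ)
  w_meas : ∀ i, Measurable (w i)
  A_meas : ∀ i, Measurable (A i)
  w_ident : ∀ i i', IdentDistrib (w i) (w i') P P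
  A_ident : ∀ i i', IdentDistrib (A i) (A i') P P
  /-- The pairs (row of errors, noise) of different observations are independent. -/
  indep : iIndepFun (fun i ω => (A i ω, w i ω)) P
  w_mean : ∀ i, ∫ ω, w i ω ∂P = 0
  A_mean : ∀ i j, ∫ ω, A i ω j ∂P = 0
  /-- The measurement error is uncorrelated with the noise. -/
  uncorr : ∀ i j, ∫ ω, A i ω j * w i ω ∂P = 0
  /-- The known covariance matrix of the rows of `A`. -/
  covA : Matrix (Fin s ⊕ Fin r) (Fin s ⊕ Fin r) ℝ
  covA_eq : ∀ i j k, ∫ ω, A i ω j * A i ω k ∂P = covA j k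
  σ : ℝ
  σ_pos : 0 < σ
  τ : ℝ
  τ_pos : 0 < τ
  w_subG : ∀ i, SubGaussianTail P (w i) σ
  /-- The rows of `A` are sub-Gaussian vectors with parameter `τ ^ 2`. -/
  A_subG : ∀ i (v : Fin s ⊕ Fin r → ℝ), l2Norm v = 1 →
    SubGaussianTail P (fun ω => v ⬝ᵥ A i ω) τ

namespace AdditiveModel

variable {n s r : ℕ} {Ω : Type*} [MeasurableSpace Ω] (M : AdditiveModel n s r Ω)

/-- The true coefficient vector `β* = (β*_S, 0)`. -/
def β : Fin s ⊕ Fin r → ℝ := Sum.elim M.βS 0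

/-- The response `y = Xβ* + w`. -/
def y (ω : Ω) : Fin n → ℝ := M.X *ᵥ M.β + fun i => M.w i ω

/-- The observed covariates `Z = X + A`. -/
def Z (ω : Ω) : Matrix (Fin n) (Fin s ⊕ Fin r) ℝ := M.X + Matrix.of fun i => M.A i ω

/-- `Σ = X'X / n`. -/
def gram : Matrix (Fin s ⊕ Fin r) (Fin s ⊕ Fin r) ℝ := (1 / (n : ℝ)) • (M.Xᵀ * M.X)

/-- `Z'Z / n - Σ_A`. -/
def gramHat (ω : Ω) : Matrix (Fin s ⊕ Fin r) (Fin s ⊕ Fin r) ℝ :=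
  (1 / (n : ℝ)) • ((M.Z ω)ᵀ * M.Z ω) - M.covA

/-- `Z'y / n`. -/
def rhoTilde (ω : Ω) : Fin s ⊕ Fin r → ℝ := (1 / (n : ℝ)) • ((M.Z ω)ᵀ *ᵥ M.y ω)

/-- `Σ_{S,S}`. -/
def gramSS : Matrix (Fin s) (Fin s) ℝ := M.gram.toBlocks₁₁

/-- `Σ_{Sᶜ,S}`. -/
def gramScS : Matrix (Fin r) (Fin s) ℝ := M.gram.toBlocks₂₁

/-- `‖β*_S‖_∞`. -/
def βmax : ℝ := ‖M.βS‖

/-- `min_{j ∈ S} |β*_j|`. -/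
def βmin : ℝ := ⨅ j, |M.βS j|

/-- The restricted eigenvalue of `Σ`. -/
def RE : ℝ := restrictedEigenvalue M.gram

/-- `γ = 1 - ‖Σ_{Sᶜ,S} Σ_{S,S}⁻¹‖_∞`. -/
def γ : ℝ := 1 - linftyNorm (M.gramScS * M.gramSS⁻¹)

/-- The least eigenvalue of `Σ_{S,S}`. -/
def Cmin : ℝ := minEigenvalue M.gramSS

/-- `κ = 4 ‖Σ_{S,S}⁻¹‖_∞ + C_min^{-1/2}`. -/
def κ : ℝ := 4 * linftyNorm M.gramSS⁻¹ + 1 / Real.sqrt M.Cmin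

/-- `max(τ², τ²‖β*_S‖_∞², τ⁴, σ⁴)`. -/
def ζ₀ : ℝ := max (max (M.τ ^ 2) (M.τ ^ 2 * M.βmax ^ 2)) (max (M.τ ^ 4) (M.σ ^ 4))

/-- The constant `ζ` of the estimation error bound. -/
def ζerr : ℝ := max (max M.ζ₀ (M.βmax ^ 2 * M.ζ₀)) (M.σ ^ 2)

/-- The constant `ζ` of the support recovery results. -/
def ζsign : ℝ := max M.ζ₀ (M.σ ^ 2)

/-- For every value `K` of `(Z'Z / n - Σ_A)₊`, the property `Q` holds for the set of all CoCoLasso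
estimates formed with `K` and the regularization parameter `lam`. -/
def ForEstimates (lam : ℝ) (ω : Ω)
    (Q : Set (Fin s ⊕ Fin r → ℝ) → Prop) : Prop :=
  ForNearestPSD (M.gramHat ω) fun K => Q {b | IsEstimate K (M.rhoTilde ω) lam b}

end AdditiveModel

end CoCoLasso

end

open CoCoLasso

/-! The randomness enters only through two deviations: the largest entry of `gramHat - gram` and the
largest entry of `rhoTilde - gram *ᵥ β`. Outside explicit bad events both are small, and the rest is
deterministic.

Projection costs a factor 2: the true Gram matrix is itself positive semi-definite, hence a
competitor, so every nearest matrix is within twice the deviation of it (`IsNearestPSD.abs_sub_le`).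
Positive semi-definiteness makes the objective convex, and the lasso arguments apply.

Error bounds (`IsEstimate.error_bound`): comparing the objective at the estimate and at `β` puts the
error in the cone of the restricted eigenvalue. There the ℓ₁ norm is at most `4√s` times the ℓ₂
norm, so an entrywise perturbation of order `1/s` costs at most half of the curvature.

Support recovery (`exists_unique_estimate`): a primal-dual witness. The problem restricted to `S` is
solved and extended by zero; irrepresentability makes the dual variable strictly smaller than `lam`
off `S`. Strictness confines every minimizer to `S`, where the perturbed block is still injective,
whence uniqueness.

Probability: each deviation is a sum of two weighted linear sums and one centred average of
products. Sub-Gaussian tails give exponential moments, hence Hoeffding and Bernstein bounds; a union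
bound runs over at most `p²` entries. For sign consistency `ε` is taken as large as the
deterministic argument allows, both exponents eventually exceed `3 log p`, and the failure
probability is at most `48 / p`. -/

noncomputable section

namespace CoCoLasso

/-! ### Concentration from sub-Gaussian tails -/

section Concentration

variable {Ω : Type*} [MeasurableSpace Ω] {P : Measure Ω}

/-- A random variable at least `0` with tail `2 / v ^ 2` has mean at most `3`. -/
lemma lintegral_ofReal_le_three [IsProbabilityMeasure P] {V : Ω → ℝ} (hV : Measurable V)
    (hV0 : ∀ ω, 0 ≤ V ω) (htail : ∀ v : ℝ, 1 < v → P.real {ω | v < V ω} ≤ 2 * v ^ (-2 : ℝ)) :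
    ∫⁻ ω, ENNReal.ofReal (V ω) ∂P ≤ 3 := by
  rw [lintegral_eq_lintegral_meas_lt P (ae_of_all _ hV0) hV.aemeasurable,
    ← Set.Ioc_union_Ioi_eq_Ioi (zero_le_one (α := ℝ))]
  refine (lintegral_union_le _ _ _).trans ?_
  have h1 : ∫⁻ t in Set.Ioc (0 : ℝ) 1, P {ω | t < V ω} ≤ 1 := by
    calc ∫⁻ t in Set.Ioc (0 : ℝ) 1, P {ω | t < V ω} ≤ ∫⁻ _ in Set.Ioc (0 : ℝ) 1, 1 :=
          lintegral_mono fun t => prob_le_one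
      _ = 1 := by simp
  have h2 : ∫⁻ t in Set.Ioi (1 : ℝ), P {ω | t < V ω} ≤ 2 := by
    calc ∫⁻ t in Set.Ioi (1 : ℝ), P {ω | t < V ω}
        ≤ ∫⁻ t in Set.Ioi (1 : ℝ), ENNReal.ofReal (2 * t ^ (-2 : ℝ)) := by
          refine setLIntegral_mono' measurableSet_Ioi fun t ht => ?_
          rw [← ofReal_measureReal]
          exact ENNReal.ofReal_le_ofReal (htail t ht)
      _ = ENNReal.ofReal (∫ t in Set.Ioi (1 : ℝ), 2 * t ^ (-2 : ℝ)) := by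
          rw [ofReal_integral_eq_lintegral_ofReal]
          · exact (integrableOn_Ioi_rpow_of_lt (by norm_num) one_pos).const_mul 2
          · refine (ae_restrict_mem measurableSet_Ioi).mono fun t ht => ?_
            have : (0 : ℝ) < t := one_pos.trans ht
            positivity
      _ = 2 := by
          rw [integral_const_mul, integral_Ioi_rpow_of_lt (by norm_num) one_pos]
          norm_num
  calc _ ≤ (1 : ENNReal) + 2 := add_le_add h1 h2
    _ = 3 := by norm_num

lemma SubGaussianTail.lintegral_exp_sq_le [IsProbabilityMeasure P] {U : Ω → ℝ} {t : ℝ}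
    (ht : 0 < t) (hU : Measurable U) (h : SubGaussianTail P U t) :
    ∫⁻ ω, ENNReal.ofReal (Real.exp (U ω ^ 2 / (4 * t ^ 2))) ∂P ≤ 3 := by
  refine lintegral_ofReal_le_three (by fun_prop) (fun ω => (Real.exp_pos _).le) fun v hv => ?_
  have hlog : 0 < Real.log v := Real.log_pos hv
  have hv0 : 0 < v := one_pos.trans hv
  -- At this level the tail bound `2 exp(-x² / (2t²))` equals `2 v⁻²`, which is integrable at
  -- infinity.
  set x : ℝ := Real.sqrt (4 * t ^ 2 * Real.log v) with hx
  have hx2 : x ^ 2 = 4 * t ^ 2 * Real.log v := Real.sq_sqrt (by positivity)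
  have hxpos : 0 < x := Real.sqrt_pos.2 (by positivity)
  have hset : {ω | v < Real.exp (U ω ^ 2 / (4 * t ^ 2))} = {ω | x < |U ω|} := by
    ext ω
    simp only [Set.mem_ofPred_eq]
    rw [← Real.log_lt_iff_lt_exp hv0, lt_div_iff₀ (by positivity), mul_comm, ← hx2,
      ← sq_abs (U ω), sq_lt_sq₀ hxpos.le (abs_nonneg _)]
  rw [hset]
  refine (h x hxpos).trans_eq ?_
  rw [hx2, Real.rpow_def_of_pos hv0]
  congr 2
  field

lemma integrable_of_lintegral_ofReal_le {V : Ω → ℝ} (hV : Measurable V) (hV0 : ∀ ω, 0 ≤ V ω)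
    {a : ℝ} (ha : 0 ≤ a) (h : ∫⁻ ω, ENNReal.ofReal (V ω) ∂P ≤ ENNReal.ofReal a) :
    Integrable V P ∧ ∫ ω, V ω ∂P ≤ a := by
  refine ⟨⟨hV.aestronglyMeasurable, ?_⟩, ?_⟩
  · rw [hasFiniteIntegral_iff_ofReal (ae_of_all _ hV0)]
    exact h.trans_lt ENNReal.ofReal_lt_top
  · rw [integral_eq_lintegral_of_nonneg_ae (ae_of_all _ hV0) hV.aestronglyMeasurable]
    exact ENNReal.toReal_le_of_le_ofReal ha h

lemma SubGaussianTail.integral_exp_sq_le [IsProbabilityMeasure P] {U : Ω → ℝ} {t : ℝ}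
    (ht : 0 < t) (hU : Measurable U) (h : SubGaussianTail P U t) :
    Integrable (fun ω => Real.exp (U ω ^ 2 / (4 * t ^ 2))) P ∧
      ∫ ω, Real.exp (U ω ^ 2 / (4 * t ^ 2)) ∂P ≤ 3 :=
  integrable_of_lintegral_ofReal_le (by fun_prop) (fun ω => (Real.exp_pos _).le) (by norm_num)
    (by simpa using h.lintegral_exp_sq_le ht hU)

lemma sq_le_exp_half_abs (x : ℝ) : x ^ 2 ≤ 8 * Real.exp (|x| / 2) := by
  have h := Real.quadratic_le_exp_of_nonneg (x := |x| / 2) (by positivity)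
  nlinarith [abs_nonneg x, sq_abs x]

/-- The second-order Taylor remainder is at most `(s x)² exp |s x|`. As `|s| ≤ 1/2`, half of the
exponent `|x|` pays for `exp |s x|` and the other half for `x²`. -/
lemma exp_mul_le_quadratic {s : ℝ} (hs : |s| ≤ 1 / 2) (x : ℝ) :
    Real.exp (s * x) ≤ 1 + s * x + 8 * s ^ 2 * Real.exp |x| := by
  have h : |Real.exp (s * x) - (1 + s * x)| ≤ |s * x| ^ 2 * Real.exp |s * x| := by
    have h := Complex.norm_exp_sub_sum_le_norm_mul_exp ((s * x : ℝ) : ℂ) 2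
    rw [Complex.norm_real, Real.norm_eq_abs, Finset.sum_range_succ, Finset.sum_range_one] at h
    rw [← Real.norm_eq_abs, ← Complex.norm_real]
    simpa using h
  rw [sq_abs, abs_mul] at h
  have h1 := (abs_le.1 h).2
  have h2 : Real.exp (|s| * |x|) ≤ Real.exp (|x| / 2) :=
    Real.exp_le_exp.2 (by nlinarith [abs_nonneg x])
  have h3 : Real.exp |x| = Real.exp (|x| / 2) * Real.exp (|x| / 2) := by
    rw [← Real.exp_add]; ring_nf
  have h4 := sq_le_exp_half_abs x
  have h5 : (s * x) ^ 2 * Real.exp (|s| * |x|)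
      ≤ s ^ 2 * (8 * Real.exp (|x| / 2)) * Real.exp (|x| / 2) := by
    rw [mul_pow]; gcongr
  rw [h3]
  linarith

/-- The moment generating function of a variable with an exponential moment, near `0`. -/
lemma mgf_le_of_integral_exp_abs_le [IsProbabilityMeasure P] {W : Ω → ℝ} (hW : Measurable W)
    {a : ℝ} (hint : Integrable (fun ω => Real.exp |W ω|) P)
    (ha : ∫ ω, Real.exp |W ω| ∂P ≤ a) {s : ℝ} (hs : |s| ≤ 1 / 2) :
    Integrable (fun ω => Real.exp (s * W ω)) P ∧
      ∫ ω, Real.exp (s * W ω) ∂P ≤ Real.exp (s * ∫ ω, W ω ∂P + 8 * a * s ^ 2) := by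
  have hWint : Integrable W P := hint.mono' hW.aestronglyMeasurable
    (ae_of_all _ fun ω => by
      rw [Real.norm_eq_abs]; linarith [Real.add_one_le_exp |W ω|])
  have hbd : Integrable (fun ω => 1 + s * W ω + 8 * s ^ 2 * Real.exp |W ω|) P :=
    ((integrable_const _).add (hWint.const_mul s)).add (hint.const_mul _)
  have hI : Integrable (fun ω => Real.exp (s * W ω)) P :=
    hbd.mono' (by fun_prop) (ae_of_all _ fun ω => by
      rw [Real.norm_eq_abs, Real.abs_exp]; exact exp_mul_le_quadratic hs _)
  refine ⟨hI, ?_⟩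
  calc ∫ ω, Real.exp (s * W ω) ∂P ≤ ∫ ω, (1 + s * W ω + 8 * s ^ 2 * Real.exp |W ω|) ∂P :=
        integral_mono hI hbd fun ω => exp_mul_le_quadratic hs _
    _ = 1 + s * ∫ ω, W ω ∂P + 8 * s ^ 2 * ∫ ω, Real.exp |W ω| ∂P := by
        have h1 : Integrable (fun ω => 1 + s * W ω) P :=
          (integrable_const _).add (hWint.const_mul s)
        rw [integral_add h1 (hint.const_mul _),
          integral_add (integrable_const _) (hWint.const_mul s), integral_const_mul,
          integral_const_mul]
        simp
    _ ≤ (s * ∫ ω, W ω ∂P + 8 * a * s ^ 2) + 1 := by nlinarith [sq_nonneg s]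
    _ ≤ _ := Real.add_one_le_exp _

/-- A centred variable with a sub-Gaussian tail has a sub-Gaussian moment generating function. -/
lemma SubGaussianTail.hasSubgaussianMGF [IsProbabilityMeasure P] {U : Ω → ℝ} {t : ℝ}
    (ht : 0 < t) (hU : Measurable U) (h : SubGaussianTail P U t) (hmean : ∫ ω, U ω ∂P = 0) :
    HasSubgaussianMGF U (256 * t ^ 2).toNNReal P := by
  obtain ⟨hint, h3⟩ := h.integral_exp_sq_le ht hU
  set W : Ω → ℝ := fun ω => U ω / (2 * t) with hWdef
  have hW : Measurable W := hU.div_const _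
  have hsq : ∀ ω, U ω ^ 2 / (4 * t ^ 2) = W ω ^ 2 := fun ω => by simp only [hWdef]; field
  simp only [hsq] at hint h3
  -- From `|W| ≤ 1/4 + W²`; the factor `4/3 ≥ exp (1/4)` turns the moment 3 into 4.
  have hle : ∀ ω, Real.exp |W ω| ≤ 4 / 3 * Real.exp (W ω ^ 2) := fun ω => by
    have h1 : Real.exp (1 / 4) ≤ 4 / 3 := by
      have := Real.exp_bound' (x := 1 / 4) (by norm_num) (by norm_num) (n := 3) (by norm_num)
      norm_num [Finset.sum_range_succ, Nat.factorial] at this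
      linarith
    calc Real.exp |W ω| ≤ Real.exp (1 / 4 + W ω ^ 2) :=
          Real.exp_le_exp.2 (by nlinarith [sq_nonneg (|W ω| - 1 / 2), sq_abs (W ω)])
      _ = Real.exp (1 / 4) * Real.exp (W ω ^ 2) := Real.exp_add _ _
      _ ≤ _ := by gcongr
  have hint' : Integrable (fun ω => Real.exp |W ω|) P :=
    (hint.const_mul (4 / 3)).mono' (by fun_prop) (ae_of_all _ fun ω => by
      rw [Real.norm_eq_abs, Real.abs_exp]; exact hle ω)
  have h4 : ∫ ω, Real.exp |W ω| ∂P ≤ 4 := by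
    calc _ ≤ ∫ ω, 4 / 3 * Real.exp (W ω ^ 2) ∂P := integral_mono hint' (hint.const_mul _) hle
      _ ≤ 4 := by rw [integral_const_mul]; linarith
  have hWmean : ∫ ω, W ω ∂P = 0 := by
    simp only [hWdef, integral_div, hmean, zero_div]
  have key : ∀ s : ℝ, Integrable (fun ω => Real.exp (s * W ω)) P ∧
      ∫ ω, Real.exp (s * W ω) ∂P ≤ Real.exp (32 * s ^ 2) := by
    intro s
    -- For small `s` the vanishing mean leaves `8 · 4 · s²`. For large `s`, `s W ≤ s²/4 + W²`, and
    -- the constant `3 ≤ exp 2` is absorbed because `s² > 1/4`.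
    by_cases hs : |s| ≤ 1 / 2
    · have := mgf_le_of_integral_exp_abs_le hW hint' h4 hs
      rw [hWmean] at this
      exact ⟨this.1, this.2.trans_eq (by norm_num)⟩
    · have hs2 : 1 / 4 < s ^ 2 := by
        rw [← sq_abs]; nlinarith [not_le.1 hs]
      have hb : ∀ ω, Real.exp (s * W ω) ≤ Real.exp (s ^ 2 / 4) * Real.exp (W ω ^ 2) := fun ω => by
        rw [← Real.exp_add]
        exact Real.exp_le_exp.2 (by nlinarith [sq_nonneg (s / 2 - W ω)])
      have hI : Integrable (fun ω => Real.exp (s * W ω)) P :=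
        (hint.const_mul (Real.exp (s ^ 2 / 4))).mono' (by fun_prop) (ae_of_all _ fun ω => by
          rw [Real.norm_eq_abs, Real.abs_exp]; exact hb ω)
      refine ⟨hI, ?_⟩
      calc _ ≤ ∫ ω, Real.exp (s ^ 2 / 4) * Real.exp (W ω ^ 2) ∂P :=
            integral_mono hI (hint.const_mul _) hb
        _ = Real.exp (s ^ 2 / 4) * ∫ ω, Real.exp (W ω ^ 2) ∂P := integral_const_mul _ _
        _ ≤ Real.exp (s ^ 2 / 4) * Real.exp 2 := by
            gcongr
            linarith [Real.add_one_le_exp (2 : ℝ)]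
        _ ≤ _ := by
            rw [← Real.exp_add]
            exact Real.exp_le_exp.2 (by linarith)
  -- Undoing the scaling, `32 (2 t s)² = 256 t² s² / 2`, which is the variance proxy `256 t²`.
  have hUW : ∀ s ω, s * U ω = (s * (2 * t)) * W ω := fun s ω => by simp only [hWdef]; field
  refine ⟨fun s => ?_, fun s => ?_⟩
  · simp only [hUW]
    exact (key _).1
  · simp only [mgf, hUW]
    refine (key _).2.trans (Real.exp_le_exp.2 ?_)
    rw [Real.coe_toNNReal _ (by positivity)]
    apply le_of_eq; ring

lemma hasSubgaussianMGF_mono {U : Ω → ℝ} {c d : NNReal} (h : HasSubgaussianMGF U c P)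
    (hcd : c ≤ d) : HasSubgaussianMGF U d P :=
  ⟨h.integrable_exp_mul, fun t => (h.mgf_le t).trans (Real.exp_le_exp.2 (by gcongr))⟩

lemma hasSubgaussianMGF_const_mul {U : Ω → ℝ} {c : ℝ} (hc : 0 ≤ c)
    (h : HasSubgaussianMGF U c.toNNReal P) (g : ℝ) :
    HasSubgaussianMGF (fun ω => g * U ω) (g ^ 2 * c).toNNReal P := by
  refine ⟨fun t => ?_, fun t => ?_⟩
  · simpa only [mul_assoc] using h.integrable_exp_mul (t * g)
  · rw [mgf_const_mul]
    refine (h.mgf_le _).trans_eq ?_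
    rw [Real.coe_toNNReal _ hc, Real.coe_toNNReal _ (by positivity)]
    ring_nf

lemma measureReal_lt_abs_le [IsFiniteMeasure P] (U : Ω → ℝ) (t : ℝ) :
    P.real {ω | t < |U ω|} ≤ P.real {ω | t ≤ U ω} + P.real {ω | t ≤ -U ω} := by
  refine (measureReal_mono (fun ω (hω : t < |U ω|) => ?_)).trans (measureReal_union_le _ _)
  rcases lt_abs.1 hω with h | h
  · exact Or.inl h.le
  · exact Or.inr h.le

/-- Hoeffding's inequality for weighted sums of independent centred variables with sub-Gaussian
tails. -/
lemma measureReal_weighted_sum_le [IsProbabilityMeasure P] {n : ℕ} {U : Fin n → Ω → ℝ} {σ : ℝ}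
    (hσ : 0 < σ) (hU : ∀ i, Measurable (U i)) (hind : iIndepFun U P)
    (hmean : ∀ i, ∫ ω, U i ω ∂P = 0) (htail : ∀ i, SubGaussianTail P (U i) σ)
    (g : Fin n → ℝ) {V : ℝ} (hV : ∑ i, g i ^ 2 ≤ V) {t : ℝ} (ht : 0 ≤ t) :
    P.real {ω | t < |∑ i, g i * U i ω|} ≤ 2 * Real.exp (-(t ^ 2 / (512 * σ ^ 2 * V))) := by
  have hV0 : 0 ≤ V := (Finset.sum_nonneg fun i _ => sq_nonneg (g i)).trans hV
  have hind' : iIndepFun (fun i ω => g i * U i ω) P :=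
    hind.comp (fun i x => g i * x) fun i => measurable_const_mul _
  have hsub := HasSubgaussianMGF.sum_of_iIndepFun hind' (s := Finset.univ) fun i _ =>
    hasSubgaussianMGF_const_mul (by positivity)
      ((htail i).hasSubgaussianMGF hσ (hU i) (hmean i)) (g i)
  have hsub' : HasSubgaussianMGF (fun ω => ∑ i, g i * U i ω) (256 * σ ^ 2 * V).toNNReal P := by
    refine hasSubgaussianMGF_mono hsub ?_
    rw [← Real.toNNReal_sum_of_nonneg fun i _ => by positivity, ← Finset.sum_mul, mul_comm]
    gcongr
  have e : -t ^ 2 / (2 * (256 * σ ^ 2 * V)) = -(t ^ 2 / (512 * σ ^ 2 * V)) := by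
    rw [neg_div]; ring_nf
  have h1 := hsub'.measure_ge_le ht
  have h2 := hsub'.neg.measure_ge_le ht
  rw [Real.coe_toNNReal _ (by positivity), e] at h1 h2
  simp only [Pi.neg_apply] at h2
  linarith [measureReal_lt_abs_le (P := P) (fun ω => ∑ i, g i * U i ω) t]

/-- The product of two variables with sub-Gaussian tails has an exponential moment. -/
lemma integral_exp_abs_mul_le [IsProbabilityMeasure P] {U V : Ω → ℝ} {t s K : ℝ}
    (ht : 0 < t) (hs : 0 < s) (hU : Measurable U) (hV : Measurable V)
    (hUt : SubGaussianTail P U t) (hVt : SubGaussianTail P V s) (htK : t ^ 2 ≤ K)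
    (hsK : s ^ 2 ≤ K) :
    Integrable (fun ω => Real.exp |U ω * V ω / (4 * K)|) P ∧
      ∫ ω, Real.exp |U ω * V ω / (4 * K)| ∂P ≤ 3 := by
  obtain ⟨hU1, hU2⟩ := hUt.integral_exp_sq_le ht hU
  obtain ⟨hV1, hV2⟩ := hVt.integral_exp_sq_le hs hV
  have hK : 0 < K := (by positivity : 0 < t ^ 2).trans_le htK
  -- The product is at most the mean of the two scaled squares, and convexity of `exp` passes to the
  -- mean of their exponentials, so the bound 3 survives.
  have hb : ∀ ω, Real.exp |U ω * V ω / (4 * K)| ≤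
      1 / 2 * Real.exp (U ω ^ 2 / (4 * t ^ 2)) + 1 / 2 * Real.exp (V ω ^ 2 / (4 * s ^ 2)) := by
    intro ω
    set a := U ω ^ 2 / (4 * t ^ 2)
    set b := V ω ^ 2 / (4 * s ^ 2)
    have ha : U ω ^ 2 / (4 * K) ≤ a := by simp only [a]; gcongr
    have hb : V ω ^ 2 / (4 * K) ≤ b := by simp only [b]; gcongr
    have h1 : |U ω * V ω / (4 * K)| ≤ (a + b) / 2 := by
      rw [abs_div, abs_mul, abs_of_pos (by positivity : 0 < 4 * K)]
      have : |U ω| * |V ω| / (4 * K) ≤ (U ω ^ 2 / (4 * K) + V ω ^ 2 / (4 * K)) / 2 := by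
        rw [← add_div, div_right_comm]
        gcongr
        nlinarith [sq_nonneg (|U ω| - |V ω|), sq_abs (U ω), sq_abs (V ω)]
      linarith
    refine (Real.exp_le_exp.2 h1).trans ?_
    have e : Real.exp ((a + b) / 2) = Real.exp (a / 2) * Real.exp (b / 2) := by
      rw [← Real.exp_add]; ring_nf
    have ea : Real.exp a = Real.exp (a / 2) ^ 2 := by rw [← Real.exp_nat_mul]; ring_nf
    have eb : Real.exp b = Real.exp (b / 2) ^ 2 := by rw [← Real.exp_nat_mul]; ring_nf
    rw [e, ea, eb]
    nlinarith [sq_nonneg (Real.exp (a / 2) - Real.exp (b / 2))]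
  have hI := (hU1.const_mul (1 / 2)).add (hV1.const_mul (1 / 2))
  have hI' : Integrable (fun ω => Real.exp |U ω * V ω / (4 * K)|) P :=
    hI.mono' (by fun_prop) (ae_of_all _ fun ω => by
      rw [Real.norm_eq_abs, Real.abs_exp]; exact hb ω)
  refine ⟨hI', (integral_mono hI' hI hb).trans ?_⟩
  simp only [Pi.add_apply]
  rw [integral_add (hU1.const_mul _) (hV1.const_mul _), integral_const_mul, integral_const_mul]
  linarith

/-- Chernoff's bound for sums of independent variables with a quadratic bound of the logarithm of
the moment generating function near `0`. -/
lemma measureReal_sum_ge_le [IsProbabilityMeasure P] {n : ℕ} {Y : Fin n → Ω → ℝ}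
    (hY : ∀ i, Measurable (Y i)) (hind : iIndepFun Y P)
    (hmgf : ∀ i s, |s| ≤ 1 / 2 → Integrable (fun ω => Real.exp (s * Y i ω)) P ∧
      ∫ ω, Real.exp (s * Y i ω) ∂P ≤ Real.exp (24 * s ^ 2)) {t : ℝ} (ht : 0 ≤ t) (ht' : t ≤ 24) :
    P.real {ω | n * t < |∑ i, Y i ω|} ≤ 2 * Real.exp (-(n * t ^ 2 / 96)) := by
  have key : ∀ Y' : Fin n → Ω → ℝ, (∀ i, Measurable (Y' i)) → iIndepFun Y' P →
      (∀ i s, |s| ≤ 1 / 2 → Integrable (fun ω => Real.exp (s * Y' i ω)) P ∧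
        ∫ ω, Real.exp (s * Y' i ω) ∂P ≤ Real.exp (24 * s ^ 2)) →
      P.real {ω | n * t ≤ (∑ i, Y' i) ω} ≤ Real.exp (-(n * t ^ 2 / 96)) := by
    intro Y' hY' hind' hm
    have hs : |t / 48| ≤ 1 / 2 := by
      rw [abs_of_nonneg (by positivity)]; linarith
    -- The parameter `t / 48` minimizes `-s t + 24 s²`, with value `-t² / 96`; the hypothesis `t ≤
    -- 24` is what keeps it within `1/2`.
    refine (measure_ge_le_exp_mul_mgf (t := t / 48) (n * t) (by positivity)
      (hind'.integrable_exp_mul_sum hY' fun i _ => (hm i _ hs).1)).trans ?_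
    rw [hind'.mgf_sum hY']
    calc _ ≤ Real.exp (-(t / 48) * (n * t)) * ∏ _i : Fin n, Real.exp (24 * (t / 48) ^ 2) := by
          gcongr with i
          · exact fun i _ => mgf_nonneg
          · exact (hm i _ hs).2
      _ = _ := by
          rw [Finset.prod_const, Finset.card_univ, Fintype.card_fin, ← Real.exp_nat_mul,
            ← Real.exp_add]
          congr 1; ring
  have h1 := key Y hY hind hmgf
  have h2 := key (fun i ω => -Y i ω) (fun i => (hY i).neg)
    (hind.comp (fun _ x => -x) fun _ => measurable_neg) fun i s hs => by
      have := hmgf i (-s) (by rwa [abs_neg])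
      simpa using this
  simp only [Finset.sum_apply, Finset.sum_neg_distrib] at h1 h2
  linarith [measureReal_lt_abs_le (P := P) (fun ω => ∑ i, Y i ω) (n * t)]

/-- Bernstein's inequality for averages of products of variables with sub-Gaussian tails. -/
lemma measureReal_average_mul_le [IsProbabilityMeasure P] {n : ℕ} (hn : 0 < n)
    {U V : Fin n → Ω → ℝ} {τ σ K m : ℝ} (hτ : 0 < τ) (hσ : 0 < σ) (hU : ∀ i, Measurable (U i))
    (hV : ∀ i, Measurable (V i)) (hind : iIndepFun (fun i ω => U i ω * V i ω) P)
    (hUt : ∀ i, SubGaussianTail P (U i) τ) (hVt : ∀ i, SubGaussianTail P (V i) σ)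
    (hmean : ∀ i, ∫ ω, U i ω * V i ω ∂P = m) (hτK : τ ^ 2 ≤ K) (hσK : σ ^ 2 ≤ K)
    {t : ℝ} (ht : 0 ≤ t) :
    P.real {ω | t < |1 / (n : ℝ) * ∑ i, U i ω * V i ω - m|} ≤
      2 * Real.exp (-(n * min (t ^ 2 / K ^ 2) 1 / 1536)) := by
  have hK : 0 < K := (by positivity : 0 < τ ^ 2).trans_le hτK
  have hn' : (0 : ℝ) < n := by exact_mod_cast hn
  -- After division by `4K` the exponential moment is at most 3, giving the coefficient `24 = 8 ·
  -- 3`. Scaling back gives `1536 = 96 · 4²`.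
  set Y : Fin n → Ω → ℝ := fun i ω => (U i ω * V i ω - m) / (4 * K) with hYdef
  have hY : ∀ i, Measurable (Y i) := fun i => by fun_prop
  have hYind : iIndepFun Y P :=
    hind.comp (fun _ x => (x - m) / (4 * K)) fun _ => by fun_prop
  have hmgf : ∀ i s, |s| ≤ 1 / 2 → Integrable (fun ω => Real.exp (s * Y i ω)) P ∧
      ∫ ω, Real.exp (s * Y i ω) ∂P ≤ Real.exp (24 * s ^ 2) := by
    intro i s hs
    obtain ⟨h1, h2⟩ := integral_exp_abs_mul_le hτ hσ (hU i) (hV i) (hUt i) (hVt i) hτK hσK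
    obtain ⟨h3, h4⟩ := mgf_le_of_integral_exp_abs_le (by fun_prop) h1 h2 hs
    have e : ∀ ω, Real.exp (s * Y i ω) =
        Real.exp (-(s * (m / (4 * K)))) * Real.exp (s * (U i ω * V i ω / (4 * K))) := fun ω => by
      rw [← Real.exp_add]; simp only [hYdef]; congr 1; ring
    simp only [e]
    refine ⟨h3.const_mul _, ?_⟩
    rw [integral_const_mul]
    refine (mul_le_mul_of_nonneg_left h4 (Real.exp_pos _).le).trans_eq ?_
    rw [← Real.exp_add, integral_div, hmean]; congr 1; ring
  have main : ∀ t' : ℝ, 0 ≤ t' → t' ≤ K →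
      P.real {ω | t' < |1 / (n : ℝ) * ∑ i, U i ω * V i ω - m|} ≤
        2 * Real.exp (-(n * (t' ^ 2 / K ^ 2) / 1536)) := by
    intro t' h0 h1
    have hset : {ω | t' < |1 / (n : ℝ) * ∑ i, U i ω * V i ω - m|} =
        {ω | n * (t' / (4 * K)) < |∑ i, Y i ω|} := by
      ext ω
      have e : ∑ i, Y i ω = (1 / (n : ℝ) * ∑ i, U i ω * V i ω - m) * (n / (4 * K)) := by
        simp only [hYdef]
        rw [← Finset.sum_div, Finset.sum_sub_distrib, Finset.sum_const, Finset.card_univ,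
          Fintype.card_fin, nsmul_eq_mul]
        field
      simp only [Set.mem_ofPred_eq, e]
      rw [abs_mul, abs_of_pos (by positivity : 0 < (n : ℝ) / (4 * K)),
        show (n : ℝ) * (t' / (4 * K)) = t' * (n / (4 * K)) by ring]
      exact (mul_lt_mul_iff_left₀ (by positivity)).symm
    rw [hset]
    refine (measureReal_sum_ge_le hY hYind hmgf (by positivity) ?_).trans_eq ?_
    · rw [div_le_iff₀ (by positivity)]; linarith
    · congr 3; field
  -- Beyond `t = K` the Gaussian regime ends; monotonicity uses the bound at `K`, hence the minimum
  -- with 1.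
  rcases le_total t K with h | h
  · refine (main t ht h).trans ?_
    gcongr
    exact min_le_left _ _
  · calc _ ≤ P.real {ω | K < |1 / (n : ℝ) * ∑ i, U i ω * V i ω - m|} :=
          measureReal_mono fun ω (hω : t < _) => h.trans_lt hω
      _ ≤ _ := main K hK.le le_rfl
      _ ≤ _ := by
          gcongr
          rw [div_self (by positivity)]
          exact min_le_right _ _

end Concentration

/-! ### Vector and matrix norms -/

section Norms

variable {m n : Type*}

lemma l1Norm_nonneg [Fintype m] (x : m → ℝ) : 0 ≤ l1Norm x :=
  Finset.sum_nonneg fun _ _ => abs_nonneg _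

lemma l1Norm_add_le [Fintype m] (x y : m → ℝ) : l1Norm (x + y) ≤ l1Norm x + l1Norm y := by
  simp only [l1Norm, ← Finset.sum_add_distrib]
  exact Finset.sum_le_sum fun i _ => abs_add_le _ _

lemma l1Norm_smul [Fintype m] (t : ℝ) (x : m → ℝ) : l1Norm (t • x) = |t| * l1Norm x := by
  simp [l1Norm, abs_mul, Finset.mul_sum]

lemma l1Norm_neg [Fintype m] (x : m → ℝ) : l1Norm (-x) = l1Norm x := by
  simp [l1Norm]

lemma norm_le_l1Norm [Fintype m] (x : m → ℝ) : ‖x‖ ≤ l1Norm x :=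
  (pi_norm_le_iff_of_nonneg (l1Norm_nonneg x)).2 fun i =>
    Finset.single_le_sum (f := fun i => |x i|) (fun _ _ => abs_nonneg _) (Finset.mem_univ i)

lemma l1Norm_sum_type [Fintype m] [Fintype n] (x : m ⊕ n → ℝ) :
    l1Norm x = l1Norm (fun j => x (Sum.inl j)) + l1Norm (fun j => x (Sum.inr j)) :=
  Fintype.sum_sum_type _

lemma l2Norm_sq [Fintype m] (x : m → ℝ) : l2Norm x ^ 2 = ∑ i, x i ^ 2 :=
  Real.sq_sqrt (Finset.sum_nonneg fun _ _ => sq_nonneg _)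

lemma abs_dotProduct_le [Fintype m] {e d : m → ℝ} {c : ℝ} (h : ∀ j, |e j| ≤ c) :
    |e ⬝ᵥ d| ≤ c * l1Norm d := by
  rw [l1Norm, Finset.mul_sum]
  refine (Finset.abs_sum_le_sum_abs _ _).trans (Finset.sum_le_sum fun i _ => ?_)
  rw [abs_mul]
  exact mul_le_mul_of_nonneg_right (h i) (abs_nonneg _)

lemma abs_dotProduct_mulVec_le [Fintype m] {D : Matrix m m ℝ} {c : ℝ} (h : ∀ i j, |D i j| ≤ c)
    (x : m → ℝ) : |x ⬝ᵥ D *ᵥ x| ≤ c * l1Norm x ^ 2 := by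
  rw [dotProduct_comm, sq, ← mul_assoc]
  exact abs_dotProduct_le fun i => abs_dotProduct_le (h i)

lemma sum_abs_le_linftyNorm [Finite m] [Fintype n] (K : Matrix m n ℝ) (i : m) :
    ∑ j, |K i j| ≤ linftyNorm K :=
  le_ciSup (f := fun i => ∑ j, |K i j|) (Set.finite_range _).bddAbove i

lemma linftyNorm_nonneg [Fintype n] (K : Matrix m n ℝ) : 0 ≤ linftyNorm K :=
  Real.iSup_nonneg fun _ => Finset.sum_nonneg fun _ _ => abs_nonneg _

lemma abs_mulVec_le_of_sum_abs_le [Fintype n] {K : Matrix m n ℝ} {i : m} {a c : ℝ}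
    (h : ∑ j, |K i j| ≤ a) {v : n → ℝ} (hc : 0 ≤ c) (hv : ∀ j, |v j| ≤ c) :
    |(K *ᵥ v) i| ≤ a * c := by
  change |K i ⬝ᵥ v| ≤ a * c
  rw [dotProduct_comm]
  refine (abs_dotProduct_le hv).trans ?_
  rw [mul_comm]
  exact mul_le_mul_of_nonneg_right h hc

lemma abs_mulVec_le_linftyNorm [Finite m] [Fintype n] (K : Matrix m n ℝ) {v : n → ℝ} {c : ℝ}
    (hc : 0 ≤ c) (hv : ∀ j, |v j| ≤ c) (i : m) : |(K *ᵥ v) i| ≤ linftyNorm K * c :=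
  abs_mulVec_le_of_sum_abs_le (sum_abs_le_linftyNorm K i) hc hv

lemma abs_le_maxNorm [Finite m] [Finite n] (K : Matrix m n ℝ) (i : m) (j : n) :
    |K i j| ≤ maxNorm K :=
  (le_ciSup (f := fun j => |K i j|) (Set.finite_range _).bddAbove j).trans
    (le_ciSup (f := fun i => ⨆ j, |K i j|) (Set.finite_range _).bddAbove i)

lemma maxNorm_le {K : Matrix m n ℝ} {c : ℝ} (hc : 0 ≤ c) (h : ∀ i j, |K i j| ≤ c) :
    maxNorm K ≤ c :=
  Real.iSup_le (fun i => Real.iSup_le (h i) hc) hc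

lemma maxNorm_nonneg (K : Matrix m n ℝ) : 0 ≤ maxNorm K :=
  Real.iSup_nonneg fun _ => Real.iSup_nonneg fun _ => abs_nonneg _

/-- The elementwise maximum norm is the norm of an iterated product of real lines. -/
lemma maxNorm_eq_norm [Fintype m] [Fintype n] (f : m → n → ℝ) :
    maxNorm (Matrix.of f) = ‖f‖ := by
  refine le_antisymm (maxNorm_le (norm_nonneg _) fun i j => ?_) ?_
  · exact (norm_le_pi_norm (f i) j).trans (norm_le_pi_norm f i)
  · refine (pi_norm_le_iff_of_nonneg (maxNorm_nonneg _)).2 fun i =>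
      (pi_norm_le_iff_of_nonneg (maxNorm_nonneg _)).2 fun j => ?_
    exact abs_le_maxNorm (Matrix.of f) i j

end Norms

/-! ### The projection onto positive semi-definite matrices -/

section NearestPSD

variable {m : Type*} [Fintype m]

lemma posSemidef_quadratic_nonneg {K : Matrix m m ℝ} (hK : K.PosSemidef) (x : m → ℝ) :
    0 ≤ x ⬝ᵥ K *ᵥ x := by
  simpa using hK.dotProduct_mulVec_nonneg x

lemma isClosed_posSemidef : IsClosed {f : m → m → ℝ | (Matrix.of f).PosSemidef} := by
  have h : {f : m → m → ℝ | (Matrix.of f).PosSemidef} =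
      (⋂ i, ⋂ j, {f : m → m → ℝ | f j i = f i j}) ∩
        ⋂ x : m → ℝ, {f : m → m → ℝ | 0 ≤ ∑ i, x i * ∑ j, f i j * x j} := by
    ext f
    simp only [Set.mem_ofPred_eq, Matrix.posSemidef_iff_dotProduct_mulVec, Set.mem_inter_iff,
      Set.mem_iInter, Matrix.IsHermitian.ext_iff]
    simp [dotProduct, Matrix.mulVec]
  rw [h]
  refine IsClosed.inter ?_ ?_
  · exact isClosed_iInter fun i => isClosed_iInter fun j =>
      isClosed_eq (by fun_prop) (by fun_prop)
  · exact isClosed_iInter fun x => isClosed_le (by fun_prop) (by fun_prop)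

/-- The cone is closed and nonempty in a finite-dimensional normed space, so the distance to it is
attained. -/
lemma exists_isNearestPSD (K : Matrix m m ℝ) : ∃ K₁, IsNearestPSD K K₁ := by
  obtain ⟨f, hf, hd⟩ := (isClosed_posSemidef (m := m)).exists_infDist_eq_dist
    ⟨0, (Matrix.PosSemidef.zero : (0 : Matrix m m ℝ).PosSemidef)⟩ (Matrix.of.symm K)
  refine ⟨Matrix.of f, hf, fun K₂ hK₂ => ?_⟩
  have h := Metric.infDist_le_dist_of_mem (x := Matrix.of.symm K) (y := Matrix.of.symm K₂)
    (s := {f : m → m → ℝ | (Matrix.of f).PosSemidef}) hK₂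
  rw [hd, dist_eq_norm, dist_eq_norm, ← maxNorm_eq_norm, ← maxNorm_eq_norm] at h
  exact h

/-- Since `G` competes in the minimization, `K₁` is at least as close to `K` as `G` is; the triangle
inequality doubles the constant. -/
lemma IsNearestPSD.abs_sub_le {K K₁ G : Matrix m m ℝ} (h : IsNearestPSD K K₁)
    (hG : G.PosSemidef) {c : ℝ} (hc : 0 ≤ c) (hKG : ∀ i j, |(K - G) i j| ≤ c) (i j : m) :
    |(K₁ - G) i j| ≤ 2 * c := by
  have h1 := (abs_le_maxNorm (K - K₁) i j).trans ((h.2 G hG).trans (maxNorm_le hc hKG))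
  have h2 := hKG i j
  simp only [Matrix.sub_apply] at *
  calc |K₁ i j - G i j| = |(K i j - G i j) - (K i j - K₁ i j)| := by congr 1; ring
    _ ≤ _ := (abs_sub _ _).trans (by linarith)

end NearestPSD

/-! ### Existence and optimality conditions of estimates -/

section Estimate

variable {m : Type*} [Fintype m] {K : Matrix m m ℝ} {ρ : m → ℝ} {lam : ℝ}

lemma dotProduct_mulVec_comm_of_posSemidef (hK : K.PosSemidef) (x y : m → ℝ) :
    x ⬝ᵥ K *ᵥ y = y ⬝ᵥ K *ᵥ x := by
  have h : Kᵀ = K := by simpa using hK.isHermitian.eq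
  rw [Matrix.dotProduct_mulVec, ← Matrix.mulVec_transpose, h, dotProduct_comm]

/-- Exact expansion, because the smooth part is quadratic; `ρ - K *ᵥ b` is its negative gradient at
`b`. The optimality conditions, the basic inequality and uniqueness all come from it. -/
lemma objective_add (hK : K.PosSemidef) (b d : m → ℝ) :
    objective K ρ lam (b + d) = objective K ρ lam b + 1 / 2 * (d ⬝ᵥ K *ᵥ d)
      - (ρ - K *ᵥ b) ⬝ᵥ d + lam * (l1Norm (b + d) - l1Norm b) := by
  have h := dotProduct_mulVec_comm_of_posSemidef hK b d
  have h' : (K *ᵥ b) ⬝ᵥ d = d ⬝ᵥ K *ᵥ b := dotProduct_comm _ _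
  simp only [objective, Matrix.mulVec_add, dotProduct_add, add_dotProduct, sub_dotProduct]
  rw [h, h']
  ring

/-- `K` may be singular, so growth has to come from the penalty. The linear term uses up at most
half of it, and what remains is nonnegative once `‖b‖₁ ≥ 3 ‖b₀‖₁`. -/
lemma exists_isEstimate (hK : K.PosSemidef) (hlam : 0 < lam) (b₀ : m → ℝ)
    (h : ∀ j, |(ρ - K *ᵥ b₀) j| ≤ lam / 2) : ∃ b, IsEstimate K ρ lam b := by
  have hcont : Continuous (objective K ρ lam) := by
    unfold objective l1Norm
    simp only [dotProduct, Matrix.mulVec]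
    fun_prop
  refine hcont.exists_forall_le' b₀ ?_
  filter_upwards [tendsto_norm_cocompact_atTop.eventually_ge_atTop (3 * l1Norm b₀)] with b hb
  have h1 : l1Norm (b - b₀) ≤ l1Norm b + l1Norm b₀ := by
    rw [sub_eq_add_neg, ← l1Norm_neg b₀]; exact l1Norm_add_le _ _
  have h2 := (abs_le.1 (abs_dotProduct_le (d := b - b₀) h)).2
  have h3 := posSemidef_quadratic_nonneg hK (b - b₀)
  have h4 := norm_le_l1Norm b
  have h5 := objective_add (ρ := ρ) (lam := lam) hK b₀ (b - b₀)
  rw [add_sub_cancel] at h5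
  rw [h5]
  nlinarith

/-- The first order condition for an estimate. -/
lemma IsEstimate.dotProduct_le {b : m → ℝ} (hb : IsEstimate K ρ lam b) (hK : K.PosSemidef)
    (hlam : 0 ≤ lam) (d : m → ℝ) :
    (ρ - K *ᵥ b) ⬝ᵥ d ≤ lam * (l1Norm (b + d) - l1Norm b) := by
  by_contra! hlt
  set q := d ⬝ᵥ K *ᵥ d with hq
  have hq0 : 0 ≤ q := posSemidef_quadratic_nonneg hK d
  set δ := (ρ - K *ᵥ b) ⬝ᵥ d - lam * (l1Norm (b + d) - l1Norm b) with hδ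
  have hδ0 : 0 < δ := sub_pos.2 hlt
  -- Moving by `t • d` gains at least `t δ` to first order, by convexity of the ℓ₁ norm, and loses
  -- `t² q / 2`; this `t` makes the gain win.
  set t := min 1 (δ / (q + 1)) with ht
  have ht0 : 0 < t := lt_min one_pos (by positivity)
  have ht1 : t ≤ 1 := min_le_left _ _
  have htq : t * (q + 1) ≤ δ := (le_div_iff₀ (by positivity)).1 (min_le_right _ _)
  have h1 := hb (b + t • d)
  rw [objective_add hK] at h1
  simp only [Matrix.mulVec_smul, dotProduct_smul, smul_dotProduct, smul_eq_mul, ← hq] at h1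
  have h2 : l1Norm (b + t • d) ≤ (1 - t) * l1Norm b + t * l1Norm (b + d) := by
    have e : b + t • d = (1 - t) • b + t • (b + d) := by
      ext i; simp only [Pi.add_apply, Pi.smul_apply, smul_eq_mul]; ring
    rw [e]
    refine (l1Norm_add_le _ _).trans ?_
    rw [l1Norm_smul, l1Norm_smul, abs_of_nonneg (by linarith : 0 ≤ 1 - t), abs_of_pos ht0]
  have h3 := mul_le_mul_of_nonneg_left h2 hlam
  have h4 : 0 ≤ t * (1 / 2 * t * q - δ) := by
    rw [hδ]; nlinarith
  have h5 := nonneg_of_mul_nonneg_right h4 ht0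
  nlinarith

/-- The directions `±e_j` bound each coordinate of the gradient; the direction `-b` gives
complementary slackness in summed form. -/
lemma IsEstimate.kkt {b : m → ℝ} (hb : IsEstimate K ρ lam b) (hK : K.PosSemidef)
    (hlam : 0 ≤ lam) :
    (∀ j, |(ρ - K *ᵥ b) j| ≤ lam) ∧ lam * l1Norm b ≤ (ρ - K *ᵥ b) ⬝ᵥ b := by
  classical
  refine ⟨fun j => ?_, ?_⟩
  · have key : ∀ u : ℝ, |u| = 1 → (ρ - K *ᵥ b) j * u ≤ lam := fun u hu => by
      have h := hb.dotProduct_le hK hlam (Pi.single j u)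
      rw [dotProduct_single] at h
      have h1 := l1Norm_add_le b (Pi.single j u)
      have h2 : l1Norm (Pi.single j u : m → ℝ) = 1 := by
        rw [l1Norm, Finset.sum_eq_single j]
        · simpa using hu
        · intro i _ hi; simp [hi]
        · simp
      nlinarith
    have h1 := key 1 (by simp)
    have h2 := key (-1) (by simp)
    exact abs_le.2 ⟨by linarith, by linarith⟩
  · have h := hb.dotProduct_le hK hlam (-b)
    rw [add_neg_cancel, dotProduct_neg] at h
    have : l1Norm (0 : m → ℝ) = 0 := by simp [l1Norm]
    rw [this] at h
    linarith

end Estimate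

/-! ### Error bounds under the restricted eigenvalue condition -/

section ErrorBound

variable {s r : ℕ}

lemma restrictedEigenvalue_mul_le {G : Matrix (Fin s ⊕ Fin r) (Fin s ⊕ Fin r) ℝ}
    (hG : G.PosSemidef) {x : Fin s ⊕ Fin r → ℝ}
    (hx : l1Norm (fun j => x (Sum.inr j)) ≤ 3 * l1Norm (fun j => x (Sum.inl j))) :
    restrictedEigenvalue G * l2Norm x ^ 2 ≤ x ⬝ᵥ G *ᵥ x := by
  rcases eq_or_ne x 0 with rfl | h0
  · simp [l2Norm]
  have hpos : 0 < l2Norm x ^ 2 := by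
    rw [l2Norm_sq]
    obtain ⟨i, hi⟩ := Function.ne_iff.1 h0
    exact Finset.sum_pos' (fun _ _ => sq_nonneg _)
      ⟨i, Finset.mem_univ i, by have : x i ≠ 0 := hi; positivity⟩
  rw [← le_div_iff₀ hpos]
  refine csInf_le ⟨0, ?_⟩ ⟨x, ⟨h0, hx⟩, rfl⟩
  rintro _ ⟨y, -, rfl⟩
  exact div_nonneg (posSemidef_quadratic_nonneg hG y) (sq_nonneg _)

lemma l1Norm_inl_le (x : Fin s ⊕ Fin r → ℝ) :
    l1Norm (fun j => x (Sum.inl j)) ≤ Real.sqrt s * l2Norm x := by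
  refine abs_le_of_sq_le_sq' ?_ (by unfold l2Norm; positivity) |>.2
  rw [mul_pow, l2Norm_sq, Real.sq_sqrt (Nat.cast_nonneg s), Fintype.sum_sum_type]
  have h := sq_sum_le_card_mul_sum_sq (s := Finset.univ) (f := fun j : Fin s => |x (Sum.inl j)|)
  simp only [sq_abs, Finset.card_univ, Fintype.card_fin] at h
  refine h.trans (mul_le_mul_of_nonneg_left ?_ (Nat.cast_nonneg s))
  exact le_add_of_nonneg_right (Finset.sum_nonneg fun _ _ => sq_nonneg _)

/-- The error bounds, on the event where the plug-in quantities are close to their targets. -/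
lemma IsEstimate.error_bound {G K : Matrix (Fin s ⊕ Fin r) (Fin s ⊕ Fin r) ℝ}
    {ρ β b : Fin s ⊕ Fin r → ℝ} {lam ε : ℝ} (hs : 0 < s) (hG : G.PosSemidef) (hK : K.PosSemidef)
    (hlam : 0 < lam) (hε : 0 ≤ ε) (hRE : 0 < restrictedEigenvalue G)
    (hεRE : ε ≤ restrictedEigenvalue G / (64 * s)) (hKG : ∀ i j, |(K - G) i j| ≤ 2 * ε)
    (hβ : ∀ j, β (Sum.inr j) = 0) (hρ : ∀ j, |(ρ - K *ᵥ β) j| ≤ lam / 2)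
    (hb : IsEstimate K ρ lam b) :
    l2Norm (b - β) ≤ 6 * lam * Real.sqrt s / restrictedEigenvalue G ∧
      l1Norm (b - β) ≤ 24 * lam * s / restrictedEigenvalue G := by
  set R := restrictedEigenvalue G
  set d := b - β with hd
  set a := l1Norm (fun j => d (Sum.inl j))
  set c := l1Norm (fun j => d (Sum.inr j))
  have hs' : (0 : ℝ) < s := by exact_mod_cast hs
  have hbd : b = β + d := by rw [hd, add_sub_cancel]
  have hl1 : l1Norm d = a + c := l1Norm_sum_type d
  have ha : 0 ≤ a := l1Norm_nonneg _
  have hc : 0 ≤ c := l1Norm_nonneg _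
  -- `β` vanishes off `S`, so the error there adds in full to the norm, while on `S` it can remove
  -- at most `a`.
  have hdiff : c - a ≤ l1Norm b - l1Norm β := by
    rw [l1Norm_sum_type b, l1Norm_sum_type β]
    have e1 : l1Norm (fun j => β (Sum.inr j)) = 0 := by simp [l1Norm, hβ]
    have e2 : l1Norm (fun j => b (Sum.inr j)) = c := by
      simp only [c, hd, Pi.sub_apply, hβ, sub_zero]
    have e3 : l1Norm (fun j => β (Sum.inl j)) ≤ l1Norm (fun j => b (Sum.inl j)) + a := by
      refine le_trans (le_of_eq ?_) ((l1Norm_add_le (fun j => b (Sum.inl j))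
        (-fun j => d (Sum.inl j))).trans_eq ?_)
      · congr 1; ext j; simp [hd]
      · rw [l1Norm_neg]
    linarith
  have hq := posSemidef_quadratic_nonneg hK d
  have hbasic : 1 / 2 * (d ⬝ᵥ K *ᵥ d) ≤ lam / 2 * (a + c) + lam * (a - c) := by
    have h1 := hb β
    rw [hbd, objective_add hK, ← hbd] at h1
    have h2 := (abs_le.1 (abs_dotProduct_le (d := d) hρ)).2
    rw [hl1] at h2
    have h3 := mul_le_mul_of_nonneg_left hdiff hlam.le
    linarith
  -- The basic inequality reads `0 ≤ d'Kd ≤ lam (3a - c)`.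
  have hcone : c ≤ 3 * a := by
    by_contra! h
    nlinarith
  have hRE' := restrictedEigenvalue_mul_le hG hcone
  set L := l2Norm d with hL
  have hL0 : 0 ≤ L := Real.sqrt_nonneg _
  have haL : a ≤ Real.sqrt s * L := l1Norm_inl_le d
  have haL2 : a ^ 2 ≤ s * L ^ 2 := by
    have := pow_le_pow_left₀ ha haL 2
    rwa [mul_pow, Real.sq_sqrt hs'.le] at this
  -- In the cone `‖d‖₁ ≤ 4a`, so the perturbation is at most `2ε · 16a²`. With `a² ≤ s L²` and `64 s
  -- ε ≤ R` this is at most half of `R L²`.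
  have hD : d ⬝ᵥ G *ᵥ d - 32 * ε * a ^ 2 ≤ d ⬝ᵥ K *ᵥ d := by
    have h1 := (abs_le.1 (abs_dotProduct_mulVec_le hKG d)).1
    rw [Matrix.sub_mulVec, dotProduct_sub, hl1] at h1
    have h2 : (a + c) ^ 2 ≤ 16 * a ^ 2 := by nlinarith
    nlinarith
  have hεs : 64 * s * ε ≤ R := by
    rw [le_div_iff₀ (by positivity)] at hεRE; linarith
  have hlow : R / 2 * L ^ 2 ≤ d ⬝ᵥ K *ᵥ d := by
    have h1 : 32 * ε * a ^ 2 ≤ 32 * ε * (s * L ^ 2) := by gcongr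
    have h2 : 64 * s * ε * L ^ 2 ≤ R * L ^ 2 := by gcongr
    linarith
  have hup : R / 2 * L ^ 2 ≤ 3 * lam * (Real.sqrt s * L) := by
    have : lam * a ≤ lam * (Real.sqrt s * L) := by gcongr
    have : 0 ≤ lam * c := by positivity
    linarith
  have hLle : L ≤ 6 * lam * Real.sqrt s / R := by
    rw [le_div_iff₀ hRE]
    rcases hL0.eq_or_lt with h | h
    · rw [← h]; simp only [zero_mul]; positivity
    · refine le_of_mul_le_mul_right ?_ h
      linarith
  refine ⟨hLle, ?_⟩
  calc l1Norm d ≤ 4 * (Real.sqrt s * L) := by rw [hl1]; linarith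
    _ ≤ 4 * (Real.sqrt s * (6 * lam * Real.sqrt s / R)) := by gcongr
    _ = 24 * lam * (Real.sqrt s * Real.sqrt s) / R := by ring
    _ = _ := by rw [Real.mul_self_sqrt hs'.le]

end ErrorBound

/-! ### Support recovery by a primal-dual witness -/

section SupportRecovery

variable {s r : ℕ}

lemma isUnit_det_of_minEigenvalue_pos {m : Type*} [Fintype m] [DecidableEq m] {K : Matrix m m ℝ}
    (h : 0 < minEigenvalue K) : IsUnit K.det := by
  rw [← Matrix.isUnit_iff_isUnit_det]
  by_contra hu
  have h0 : (0 : ℝ) ∈ spectrum ℝ K := spectrum.zero_mem ℝ hu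
  exact absurd (csInf_le (Matrix.finite_real_spectrum (A := K)).bddBelow h0) (not_le.2 h)

/-- The primal-dual witness construction, on the event where the plug-in quantities are close to
their targets. -/
lemma exists_unique_estimate {G K : Matrix (Fin s ⊕ Fin r) (Fin s ⊕ Fin r) ℝ}
    {ρ : Fin s ⊕ Fin r → ℝ} {βS : Fin s → ℝ} {lam ε γ φ : ℝ} (hs : 0 < s)
    (hK : K.PosSemidef) (hlam : 0 < lam) (hε : 0 ≤ ε)
    (hdet : IsUnit G.toBlocks₁₁.det) (hφ : φ = linftyNorm G.toBlocks₁₁⁻¹)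
    (hγ : γ = 1 - linftyNorm (G.toBlocks₂₁ * G.toBlocks₁₁⁻¹)) (hγ0 : 0 < γ)
    (hKG : ∀ i j, |(K - G) i j| ≤ 2 * (ε / s))
    (hρ : ∀ j, |(ρ - G *ᵥ Sum.elim βS 0) j| ≤ γ * lam / 16)
    (h1 : 4 * ε * φ ≤ 1) (h2 : 32 * ε * φ ≤ γ) (h3 : 32 * ε * ‖βS‖ ≤ γ * lam) :
    ∃ b, {b | IsEstimate K ρ lam b} = {b} ∧ (∀ j, b (Sum.inr j) = 0) ∧
      ∀ j, |b (Sum.inl j) - βS j| ≤ 3 * φ * lam := by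
  have hs' : (0 : ℝ) < s := by exact_mod_cast hs
  have hγ1 : γ ≤ 1 := by rw [hγ]; linarith [linftyNorm_nonneg (G.toBlocks₂₁ * G.toBlocks₁₁⁻¹)]
  have hφ0 : 0 ≤ φ := hφ ▸ linftyNorm_nonneg _
  have hγlam : γ * lam ≤ lam := by nlinarith
  set D := K - G with hD
  have hKD : K = G + D := by rw [hD, add_sub_cancel]
  -- Row sums run over the `s` columns in `S`; this is why the entrywise accuracy is `ε / s`.
  have hrow : ∀ i, ∑ j : Fin s, |D i (Sum.inl j)| ≤ 2 * ε := fun i => by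
    calc _ ≤ ∑ _j : Fin s, 2 * (ε / s) := Finset.sum_le_sum fun j _ => hKG i _
      _ = _ := by rw [Finset.sum_const, Finset.card_univ, Fintype.card_fin, nsmul_eq_mul]; field
  -- the action on vectors supported in the first block
  have hblock : ∀ (N : Matrix (Fin s ⊕ Fin r) (Fin s ⊕ Fin r) ℝ) (v : Fin s → ℝ),
      N *ᵥ Sum.elim v 0 = Sum.elim (N.toBlocks₁₁ *ᵥ v) (N.toBlocks₂₁ *ᵥ v) := fun N v => by
    ext (i | i) <;>
      simp [Matrix.mulVec, dotProduct, Matrix.toBlocks₁₁, Matrix.toBlocks₂₁]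
  set β : Fin s ⊕ Fin r → ℝ := Sum.elim βS 0 with hβ
  have he : ∀ j, |(ρ - K *ᵥ β) j| ≤ γ * lam / 8 := fun j => by
    have hDβ : |(D *ᵥ β) j| ≤ 2 * ε * ‖βS‖ := by
      have e : (D *ᵥ β) j = (Matrix.of (fun i k => D i (Sum.inl k)) *ᵥ βS) j := by
        simp [Matrix.mulVec, dotProduct, hβ]
      rw [e]
      exact abs_mulVec_le_of_sum_abs_le (hrow j) (norm_nonneg _) fun k => norm_le_pi_norm βS k
    have e : (ρ - K *ᵥ β) j = (ρ - G *ᵥ β) j - (D *ᵥ β) j := by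
      rw [hKD, Matrix.add_mulVec]; simp only [Pi.sub_apply, Pi.add_apply]; ring
    rw [e]
    refine (abs_sub _ _).trans ?_
    linarith [hρ j]
  have he' : ∀ j, |(ρ - K *ᵥ β) j| ≤ lam / 2 := fun j => (he j).trans (by linarith)
  set KS := K.toBlocks₁₁ with hKS
  have hKSpsd : KS.PosSemidef := hK.submatrix Sum.inl
  have heS : ∀ j, (ρ - K *ᵥ β) (Sum.inl j) = ((fun j => ρ (Sum.inl j)) - KS *ᵥ βS) j := fun j => by
    rw [hβ, hblock]; rfl
  -- stability of the inverse
  have hinv : ∀ (v : Fin s → ℝ) (c : ℝ), 0 ≤ c → (∀ j, |(KS *ᵥ v) j| ≤ c) →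
      ∀ j, |v j| ≤ 2 * φ * c := by
    intro v c hc hv
    have e : v = G.toBlocks₁₁⁻¹ *ᵥ (KS *ᵥ v - D.toBlocks₁₁ *ᵥ v) := by
      have : KS *ᵥ v - D.toBlocks₁₁ *ᵥ v = G.toBlocks₁₁ *ᵥ v := by
        have : KS = G.toBlocks₁₁ + D.toBlocks₁₁ := by rw [hKS, hKD]; rfl
        rw [this, Matrix.add_mulVec, add_sub_cancel_right]
      rw [this, Matrix.mulVec_mulVec, Matrix.nonsing_inv_mul _ hdet, Matrix.one_mulVec]
    have hle : ∀ j, |v j| ≤ φ * (c + 2 * ε * ‖v‖) := fun j => by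
      conv_lhs => rw [e]
      rw [hφ]
      refine abs_mulVec_le_linftyNorm _ (by positivity) (fun k => ?_) j
      refine (abs_sub _ _).trans (add_le_add (hv k) ?_)
      exact abs_mulVec_le_of_sum_abs_le (hrow (Sum.inl k)) (norm_nonneg _)
        fun k => norm_le_pi_norm v k
    have hn : ‖v‖ ≤ φ * (c + 2 * ε * ‖v‖) :=
      (pi_norm_le_iff_of_nonneg (by positivity)).2 hle
    -- Since `4εφ ≤ 1`, the term `2εφ‖v‖` is absorbed into half of the left side.
    have hn' : ‖v‖ ≤ 2 * φ * c := by
      have : 4 * ε * φ * ‖v‖ ≤ 1 * ‖v‖ := by gcongr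
      linarith
    exact fun j => (norm_le_pi_norm v j).trans hn'
  obtain ⟨bS, hbS⟩ := exists_isEstimate (ρ := fun j => ρ (Sum.inl j)) hKSpsd hlam βS
    fun j => (heS j) ▸ he' _
  obtain ⟨hk1, hk2⟩ := hbS.kkt hKSpsd hlam.le
  set b : Fin s ⊕ Fin r → ℝ := Sum.elim bS 0 with hb
  set g := ρ - K *ᵥ b with hg
  have hgS : ∀ j, g (Sum.inl j) = ((fun j => ρ (Sum.inl j)) - KS *ᵥ bS) j := fun j => by
    rw [hg, hb, hblock]; rfl
  set Δ := bS - βS with hΔ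
  have hKΔ : ∀ i, (K *ᵥ Sum.elim Δ 0) i = (ρ - K *ᵥ β) i - g i := fun i => by
    have : (Sum.elim Δ 0 : Fin s ⊕ Fin r → ℝ) = b - β := by
      ext (j | j) <;> simp [hΔ, hb, hβ]
    rw [this, Matrix.mulVec_sub]; simp only [hg, Pi.sub_apply]; ring
  have hKSΔ : ∀ j, (KS *ᵥ Δ) j = (ρ - K *ᵥ β) (Sum.inl j) - g (Sum.inl j) := fun j => by
    rw [← hKΔ, hblock]; rfl
  have hKSΔle : ∀ j, |(KS *ᵥ Δ) j| ≤ γ * lam / 8 + lam := fun j => by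
    rw [hKSΔ]
    refine (abs_sub _ _).trans (add_le_add (he _) ?_)
    rw [hgS]; exact hk1 j
  have hΔle : ∀ j, |Δ j| ≤ 3 * φ * lam := fun j => by
    refine (hinv Δ _ (by positivity) hKSΔle j).trans ?_
    have : φ * (γ * lam) ≤ φ * lam := by gcongr
    have : 0 ≤ φ * lam := by positivity
    linarith
  -- strict dual feasibility
  have hstrict : ∀ j, |g (Sum.inr j)| < lam := fun j => by
    set M := G.toBlocks₂₁ * G.toBlocks₁₁⁻¹ with hM
    have hMG : G.toBlocks₂₁ = M * G.toBlocks₁₁ := by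
      rw [hM, Matrix.mul_assoc, Matrix.nonsing_inv_mul _ hdet, Matrix.mul_one]
    have hMrow : linftyNorm M = 1 - γ := by rw [hγ]; ring
    -- Writing `G₂₁ = M G₁₁` exposes the known vector `KS *ᵥ Δ`, bounded by about `lam`, behind the
    -- factor `‖M‖_∞ = 1 - γ`. The remaining errors add up to at most `5γ lam / 8`, less than the
    -- slack `γ lam`.
    have e1 : (K *ᵥ Sum.elim Δ 0) (Sum.inr j) =
        (M *ᵥ (KS *ᵥ Δ)) j - (M *ᵥ (D.toBlocks₁₁ *ᵥ Δ)) j + (D.toBlocks₂₁ *ᵥ Δ) j := by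
      have a1 : KS = G.toBlocks₁₁ + D.toBlocks₁₁ := by rw [hKS, hKD]; rfl
      have a2 : K.toBlocks₂₁ = M * G.toBlocks₁₁ + D.toBlocks₂₁ := by
        rw [← hMG, hKD]; rfl
      rw [hblock, Sum.elim_inr, a2, a1, Matrix.add_mulVec, Matrix.add_mulVec, Matrix.mulVec_add,
        ← Matrix.mulVec_mulVec]
      simp only [Pi.add_apply]; ring
    have b1 : |(M *ᵥ (KS *ᵥ Δ)) j| ≤ (1 - γ) * (γ * lam / 8 + lam) :=
      hMrow ▸ abs_mulVec_le_linftyNorm M (by positivity) hKSΔle j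
    have hD1 : ∀ k, |(D.toBlocks₁₁ *ᵥ Δ) k| ≤ 2 * ε * (3 * φ * lam) := fun k =>
      abs_mulVec_le_of_sum_abs_le (hrow (Sum.inl k)) (by positivity) hΔle
    have b2 : |(M *ᵥ (D.toBlocks₁₁ *ᵥ Δ)) j| ≤ (1 - γ) * (2 * ε * (3 * φ * lam)) :=
      hMrow ▸ abs_mulVec_le_linftyNorm M (by positivity) hD1 j
    have b3 : |(D.toBlocks₂₁ *ᵥ Δ) j| ≤ 2 * ε * (3 * φ * lam) :=
      abs_mulVec_le_of_sum_abs_le (hrow (Sum.inr j)) (by positivity) hΔle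
    have b4 := he (Sum.inr j)
    have e2 : g (Sum.inr j) = (ρ - K *ᵥ β) (Sum.inr j) - (K *ᵥ Sum.elim Δ 0) (Sum.inr j) := by
      rw [hKΔ]; ring
    have b5 : 32 * ε * φ * lam ≤ γ * lam := by gcongr
    have b6 : 0 ≤ ε * φ * lam := by positivity
    have b7 : 0 ≤ γ * (ε * φ * lam) := by positivity
    have b8 : 0 < γ * lam := by positivity
    have b9 : 0 ≤ γ * (γ * lam) := by positivity
    rw [e2, e1]
    rw [abs_le] at b1 b2 b3 b4
    rw [abs_lt]
    constructor <;> linarith [b1.1, b1.2, b2.1, b2.2, b3.1, b3.2, b4.1, b4.2]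
  have hgle : ∀ j, |g j| ≤ lam
    | Sum.inl j => by rw [hgS]; exact hk1 j
    | Sum.inr j => (hstrict j).le
  have hgb : lam * l1Norm b = g ⬝ᵥ b := by
    refine le_antisymm ?_ ((le_abs_self _).trans (abs_dotProduct_le hgle))
    have e1 : l1Norm b = l1Norm bS := by rw [l1Norm_sum_type]; simp [hb, l1Norm]
    have e2 : g ⬝ᵥ b = ((fun j => ρ (Sum.inl j)) - KS *ᵥ bS) ⬝ᵥ bS := by
      simp only [dotProduct, Fintype.sum_sum_type, hgS]
      simp [hb]
    rw [e1, e2]; exact hk2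
  -- The excess over the witness is a sum of nonnegative terms. So the witness is optimal, and at
  -- another minimizer each term vanishes: the slack terms force zeros off `S`, the quadratic form
  -- puts `b' - b` in the kernel of `K`.
  have hdecomp : ∀ b', objective K ρ lam b' = objective K ρ lam b +
      1 / 2 * ((b' - b) ⬝ᵥ K *ᵥ (b' - b)) + ∑ j, (lam * |b' j| - g j * b' j) := fun b' => by
    have h := objective_add (ρ := ρ) (lam := lam) hK b (b' - b)
    rw [add_sub_cancel] at h
    rw [h, Finset.sum_sub_distrib, ← Finset.mul_sum]
    change _ = _ + (lam * l1Norm b' - g ⬝ᵥ b')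
    rw [← hg, dotProduct_sub, mul_sub, hgb]; ring
  have hterm : ∀ (b' : Fin s ⊕ Fin r → ℝ) j, 0 ≤ lam * |b' j| - g j * b' j := fun b' j => by
    have a1 := le_abs_self (g j * b' j)
    rw [abs_mul] at a1
    have a2 : |g j| * |b' j| ≤ lam * |b' j| := by gcongr; exact hgle j
    linarith
  have hbest : IsEstimate K ρ lam b := fun b' => by
    rw [hdecomp b']
    have := posSemidef_quadratic_nonneg hK (b' - b)
    have := Finset.sum_nonneg fun j (_ : j ∈ Finset.univ) => hterm b' j
    linarith
  refine ⟨b, Set.eq_singleton_iff_unique_mem.2 ⟨hbest, fun b' hb' => ?_⟩, fun j => rfl,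
    fun j => hΔle j⟩
  have a1 : objective K ρ lam b' ≤ objective K ρ lam b := hb' b
  rw [hdecomp b'] at a1
  have a2 := posSemidef_quadratic_nonneg hK (b' - b)
  have a3 := Finset.sum_nonneg fun j (_ : j ∈ Finset.univ) => hterm b' j
  have a4 : ∑ j, (lam * |b' j| - g j * b' j) = 0 := by linarith
  have a5 : (b' - b) ⬝ᵥ K *ᵥ (b' - b) = 0 := by linarith
  have a6 : ∀ j, b' (Sum.inr j) = 0 := fun j => by
    have c1 := (Finset.sum_eq_zero_iff_of_nonneg fun j _ => hterm b' j).1 a4 (Sum.inr j)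
      (Finset.mem_univ _)
    by_contra hne
    have c2 : |g (Sum.inr j)| * |b' (Sum.inr j)| < lam * |b' (Sum.inr j)| :=
      mul_lt_mul_of_pos_right (hstrict j) (abs_pos.2 hne)
    have c3 := le_abs_self (g (Sum.inr j) * b' (Sum.inr j))
    rw [abs_mul] at c3
    linarith
  have a7 : K *ᵥ (b' - b) = 0 := by
    rw [← hK.dotProduct_mulVec_zero_iff]
    simpa using a5
  set v : Fin s → ℝ := fun j => (b' - b) (Sum.inl j) with hv
  have a8 : b' - b = Sum.elim v 0 := by
    ext (j | j)
    · rfl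
    · simp [a6, hb]
  -- `K` itself may be singular, but stability of the inverse with `c = 0` makes its `S` block
  -- injective.
  have a9 : ∀ j, |v j| ≤ 2 * φ * 0 := hinv v 0 le_rfl fun j => by
    have : (KS *ᵥ v) j = (K *ᵥ (b' - b)) (Sum.inl j) := by rw [a8, hblock]; rfl
    rw [this, a7]; simp
  rw [← sub_eq_zero, a8]
  ext (j | j)
  · have := a9 j
    rw [mul_zero] at this
    exact abs_nonpos_iff.1 this
  · rfl

end SupportRecovery

/-! ### Bad events and their probabilities -/

lemma holdsWithProb_one_sub {Ω : Type*} [MeasurableSpace Ω] {P : Measure Ω}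
    [IsProbabilityMeasure P] {N : Set Ω} (hN : MeasurableSet N) {δ : ℝ} (hδ : P.real N ≤ δ)
    {Q : Ω → Prop} (hQ : ∀ ω, ω ∉ N → Q ω) : HoldsWithProb P (1 - δ) Q := by
  refine ⟨Nᶜ, hN.compl, ?_, fun ω hω => hQ ω hω⟩
  rw [probReal_compl_eq_one_sub hN]
  linarith

lemma holdsWithProb_zero {Ω : Type*} [MeasurableSpace Ω] (P : Measure Ω) (Q : Ω → Prop) :
    HoldsWithProb P 0 Q :=
  ⟨∅, MeasurableSet.empty, by simp, fun _ h => h.elim⟩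

namespace AdditiveModel

variable {n s r : ℕ} {Ω : Type*} [MeasurableSpace Ω] (M : AdditiveModel n s r Ω)

/-- For `n = 0` the normalization of the column in `S` would read `0 = 1`. -/
lemma n_pos (M : AdditiveModel n s r Ω) : 0 < n := by
  rcases Nat.eq_zero_or_pos n with rfl | h
  · have := M.X_norm (Sum.inl ⟨0, M.s_pos⟩)
    simp at this
  · exact h

lemma sum_X_sq (j : Fin s ⊕ Fin r) : ∑ i, M.X i j ^ 2 = n := by
  have h := M.X_norm j
  have hn : (n : ℝ) ≠ 0 := by exact_mod_cast M.n_pos.ne'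
  field_simp at h
  exact h

lemma sum_weight_sq (j : Fin s ⊕ Fin r) : ∑ i, (M.X i j / n) ^ 2 = 1 / n := by
  have hn : (n : ℝ) ≠ 0 := by exact_mod_cast M.n_pos.ne'
  simp only [div_pow]
  rw [← Finset.sum_div, M.sum_X_sq]
  field

lemma gram_posSemidef : M.gram.PosSemidef := by
  have h := (Matrix.posSemidef_conjTranspose_mul_self M.X).smul
    (by positivity : (0 : ℝ) ≤ 1 / (n : ℝ))
  simpa [gram] using h

/-- Expanding `(X + A)'(X + A)` leaves two linear sums with fixed weights, for Hoeffding, and one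
centred average of products, for Bernstein. -/
lemma gramHat_sub_gram (ω : Ω) (j k : Fin s ⊕ Fin r) :
    (M.gramHat ω - M.gram) j k = ∑ i, M.X i j / n * M.A i ω k + ∑ i, M.X i k / n * M.A i ω j
      + (1 / (n : ℝ) * ∑ i, M.A i ω j * M.A i ω k - M.covA j k) := by
  simp only [gramHat, gram, Z, Matrix.sub_apply, Matrix.smul_apply, Matrix.mul_apply,
    Matrix.transpose_apply, Matrix.add_apply, Matrix.of_apply, smul_eq_mul, Finset.mul_sum]
  rw [sub_right_comm, ← Finset.sum_sub_distrib, ← Finset.sum_add_distrib, ← add_sub_assoc,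
    ← Finset.sum_add_distrib]
  congr 1
  refine Finset.sum_congr rfl fun i _ => ?_
  ring

/-- The analogous splitting; the final `- 0` displays the mean of `a_ij w_i` in the shape of
Bernstein's inequality. -/
lemma rhoTilde_sub (ω : Ω) (j : Fin s ⊕ Fin r) :
    (M.rhoTilde ω - M.gram *ᵥ M.β) j = ∑ i, M.X i j / n * M.w i ω
      + ∑ i, (M.X *ᵥ M.β) i / n * M.A i ω j
      + (1 / (n : ℝ) * ∑ i, M.A i ω j * M.w i ω - 0) := by
  have e : M.gram *ᵥ M.β = (1 / (n : ℝ)) • (M.Xᵀ *ᵥ (M.X *ᵥ M.β)) := by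
    rw [gram, Matrix.smul_mulVec, Matrix.mulVec_mulVec]
  rw [e]
  generalize hv : M.X *ᵥ M.β = v
  simp only [rhoTilde, y, Z, hv, Pi.sub_apply, Pi.smul_apply, Matrix.mulVec, dotProduct,
    Matrix.transpose_apply, Matrix.add_apply, Matrix.of_apply, smul_eq_mul, Finset.mul_sum,
    Pi.add_apply, sub_zero]
  rw [← Finset.sum_sub_distrib, ← Finset.sum_add_distrib, ← Finset.sum_add_distrib]
  refine Finset.sum_congr rfl fun i _ => ?_
  ring

lemma A_apply_measurable (i : Fin n) (j : Fin s ⊕ Fin r) : Measurable fun ω => M.A i ω j :=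
  (measurable_pi_apply j).comp (M.A_meas i)

lemma A_apply_subG (i : Fin n) (j : Fin s ⊕ Fin r) :
    SubGaussianTail M.P (fun ω => M.A i ω j) M.τ := by
  have h := M.A_subG i (Pi.single j 1) (by
    rw [l2Norm, Finset.sum_eq_single j]
    · simp
    · intro k _ hk; simp [hk]
    · simp)
  simpa using h

lemma indep_A (j : Fin s ⊕ Fin r) : iIndepFun (fun i ω => M.A i ω j) M.P :=
  M.indep.comp (fun _ q => q.1 j) fun _ => (measurable_pi_apply j).comp measurable_fst

lemma indep_w : iIndepFun M.w M.P :=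
  M.indep.comp (fun _ q => q.2) fun _ => measurable_snd

lemma indep_A_mul_A (j k : Fin s ⊕ Fin r) :
    iIndepFun (fun i ω => M.A i ω j * M.A i ω k) M.P :=
  M.indep.comp (fun _ q => q.1 j * q.1 k) fun _ =>
    ((measurable_pi_apply j).comp measurable_fst).mul ((measurable_pi_apply k).comp measurable_fst)

lemma indep_A_mul_w (j : Fin s ⊕ Fin r) : iIndepFun (fun i ω => M.A i ω j * M.w i ω) M.P :=
  M.indep.comp (fun _ q => q.1 j * q.2) fun _ =>
    ((measurable_pi_apply j).comp measurable_fst).mul measurable_snd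

/-- Cauchy-Schwarz over the support: one factor `s` comes from `∑ β_j²`, the other from the `s`
normalized columns. It is the source of `s⁻²` in the exponent for `rhoTilde`. -/
lemma sum_mulVec_sq_le :
    ∑ i, ((M.X *ᵥ M.β) i / n) ^ 2 ≤ (s : ℝ) ^ 2 * M.βmax ^ 2 / n := by
  have hn : (0 : ℝ) < n := by exact_mod_cast M.n_pos
  have h : ∀ i, (M.X *ᵥ M.β) i ^ 2 ≤
      (∑ j : Fin s, M.X i (Sum.inl j) ^ 2) * (s * M.βmax ^ 2) := fun i => by
    have e : (M.X *ᵥ M.β) i = ∑ j : Fin s, M.X i (Sum.inl j) * M.βS j := by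
      simp [Matrix.mulVec, dotProduct, β]
    rw [e]
    refine (Finset.sum_mul_sq_le_sq_mul_sq _ _ _).trans ?_
    gcongr
    calc ∑ j, M.βS j ^ 2 ≤ ∑ _j : Fin s, M.βmax ^ 2 := by
          refine Finset.sum_le_sum fun j _ => ?_
          rw [← sq_abs]
          exact pow_le_pow_left₀ (abs_nonneg _) (norm_le_pi_norm M.βS j) 2
      _ = _ := by rw [Finset.sum_const, Finset.card_univ, Fintype.card_fin, nsmul_eq_mul]
  simp only [div_pow]
  rw [← Finset.sum_div]
  have h2 : ∑ i, (M.X *ᵥ M.β) i ^ 2 ≤ s * n * (s * M.βmax ^ 2) := by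
    refine (Finset.sum_le_sum fun i _ => h i).trans_eq ?_
    rw [← Finset.sum_mul, Finset.sum_comm]
    simp only [sum_X_sq, Finset.sum_const, Finset.card_univ, Fintype.card_fin, nsmul_eq_mul]
  calc _ ≤ s * n * (s * M.βmax ^ 2) / (n : ℝ) ^ 2 := by gcongr
    _ = _ := by field

lemma βmax_pos : 0 < M.βmax := by
  have := norm_le_pi_norm M.βS ⟨0, M.s_pos⟩
  exact (norm_pos_iff.2 (M.βS_ne ⟨0, M.s_pos⟩)).trans_le this

/-- The event that `Z'Z / n - Σ_A` is far from `Σ`. -/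
def gramBad (t : ℝ) : Set Ω := {ω | ∃ j k, t < |(M.gramHat ω - M.gram) j k|}

/-- The event that `Z'y / n` is far from `Σβ*`. -/
def rhoBad (t : ℝ) : Set Ω := {ω | ∃ j, t < |(M.rhoTilde ω - M.gram *ᵥ M.β) j|}

lemma measurableSet_gramBad (t : ℝ) : MeasurableSet (M.gramBad t) := by
  have e : M.gramBad t = ⋃ j, ⋃ k, {ω | t < |(M.gramHat ω - M.gram) j k|} := by
    ext; simp [gramBad]
  rw [e]
  refine MeasurableSet.iUnion fun j => MeasurableSet.iUnion fun k => ?_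
  simp only [gramHat_sub_gram]
  have := M.A_apply_measurable
  exact measurableSet_lt measurable_const (by fun_prop)

lemma measurableSet_rhoBad (t : ℝ) : MeasurableSet (M.rhoBad t) := by
  have e : M.rhoBad t = ⋃ j, {ω | t < |(M.rhoTilde ω - M.gram *ᵥ M.β) j|} := by
    ext; simp [rhoBad]
  rw [e]
  refine MeasurableSet.iUnion fun j => ?_
  simp only [rhoTilde_sub]
  have := M.A_apply_measurable
  have := M.w_meas
  exact measurableSet_lt measurable_const (by fun_prop)

lemma measureReal_lt_abs_add_le {P : Measure Ω} [IsFiniteMeasure P] (U V W : Ω → ℝ) (t : ℝ) :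
    P.real {ω | t < |U ω + V ω + W ω|} ≤
      P.real {ω | t / 3 < |U ω|} + P.real {ω | t / 3 < |V ω|} + P.real {ω | t / 3 < |W ω|} := by
  refine (measureReal_mono (s₂ := ({ω | t / 3 < |U ω|} ∪ {ω | t / 3 < |V ω|}) ∪
    {ω | t / 3 < |W ω|}) fun ω (hω : t < _) => ?_).trans ((measureReal_union_le _ _).trans
      (add_le_add_left (measureReal_union_le _ _) _))
  by_contra hc
  simp only [Set.mem_union, Set.mem_ofPred_eq, not_or, not_lt] at hc
  have := abs_add_three (U ω) (V ω) (W ω)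
  linarith [hc.1.1, hc.1.2, hc.2]

/-- The three-way split replaces `t` by `t / 3`, and `13824 = 9 · 1536`. The two hypotheses match
the two branches of the minimum. -/
lemma exp_bound_le {n K t E : ℝ} (hK : 0 < K) (hn : 0 ≤ n)
    (h1 : E ≤ 1 / 13824 * (n * (t ^ 2 / K ^ 2))) (h2 : E ≤ 1 / 13824 * n) :
    2 * Real.exp (-(n * min ((t / 3) ^ 2 / K ^ 2) 1 / 1536)) ≤ 2 * Real.exp (-E) := by
  gcongr
  have e : (t / 3) ^ 2 / K ^ 2 = (t ^ 2 / K ^ 2) / 9 := by field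
  rw [e]
  rcases min_cases (t ^ 2 / K ^ 2 / 9) 1 with h | h <;> rw [h.1] <;> linarith

lemma exp_weighted_bound_le {n a V t E : ℝ} (hn : 0 < n) (hV : 0 < V) (ha : 0 < a)
    (ht : 0 < t) (h : E ≤ 1 / 13824 * (n * (t ^ 2 / (a ^ 2 * V)))) :
    2 * Real.exp (-((t / 3) ^ 2 / (512 * a ^ 2 * (V / n)))) ≤ 2 * Real.exp (-E) := by
  gcongr
  refine h.trans ?_
  have e : (t / 3) ^ 2 / (512 * a ^ 2 * (V / n)) = 1 / 4608 * (n * (t ^ 2 / (a ^ 2 * V))) := by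
    field
  rw [e]
  gcongr
  norm_num

lemma measureReal_gramBad_le {t E : ℝ} (ht : 0 < t)
    (h1 : E ≤ 1 / 13824 * (n * (t ^ 2 / M.τ ^ 2))) (h2 : E ≤ 1 / 13824 * (n * (t ^ 2 / M.τ ^ 4)))
    (h3 : E ≤ 1 / 13824 * n) :
    M.P.real (M.gramBad t) ≤ ((s + r : ℕ) : ℝ) ^ 2 * (6 * Real.exp (-E)) := by
  have := M.isProb
  have hτ := M.τ_pos
  have hn : (0 : ℝ) < n := by exact_mod_cast M.n_pos
  have hlin : ∀ j k, M.P.real {ω | t / 3 < |∑ i, M.X i j / n * M.A i ω k|} ≤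
      2 * Real.exp (-E) := fun j k =>
    (measureReal_weighted_sum_le hτ (fun i => M.A_apply_measurable i k) (M.indep_A k)
      (fun i => M.A_mean i k) (fun i => M.A_apply_subG i k) _ (M.sum_weight_sq j).le
      (by positivity)).trans (exp_weighted_bound_le hn one_pos hτ ht (by simpa using h1))
  have hquad : ∀ j k, M.P.real {ω | t / 3 <
      |1 / (n : ℝ) * ∑ i, M.A i ω j * M.A i ω k - M.covA j k|} ≤ 2 * Real.exp (-E) := fun j k =>
    (measureReal_average_mul_le M.n_pos hτ hτ (fun i => M.A_apply_measurable i j)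
      (fun i => M.A_apply_measurable i k) (M.indep_A_mul_A j k) (fun i => M.A_apply_subG i j)
      (fun i => M.A_apply_subG i k) (fun i => M.covA_eq i j k) le_rfl le_rfl
      (by positivity)).trans (exp_bound_le (by positivity) hn.le (by
        rw [← pow_mul]; exact h2) h3)
  have e : M.gramBad t = ⋃ j, ⋃ k, {ω | t < |(M.gramHat ω - M.gram) j k|} := by
    ext; simp [gramBad]
  rw [e]
  calc _ ≤ ∑ j, ∑ k, M.P.real {ω | t < |(M.gramHat ω - M.gram) j k|} :=
        (measureReal_iUnion_fintype_le _).trans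
          (Finset.sum_le_sum fun j _ => measureReal_iUnion_fintype_le _)
    _ ≤ ∑ _j : Fin s ⊕ Fin r, ∑ _k : Fin s ⊕ Fin r, 6 * Real.exp (-E) := by
        refine Finset.sum_le_sum fun j _ => Finset.sum_le_sum fun k _ => ?_
        simp only [gramHat_sub_gram]
        refine (measureReal_lt_abs_add_le _ _ _ _).trans ?_
        linarith [hlin j k, hlin k j, hquad j k]
    _ = _ := by
        simp only [Finset.sum_const, Finset.card_univ, Fintype.card_sum, Fintype.card_fin,
          nsmul_eq_mul]
        ring

lemma one_le_card (M : AdditiveModel n s r Ω) : (1 : ℝ) ≤ ((s + r : ℕ) : ℝ) := by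
  exact_mod_cast (Nat.le_add_right_of_le M.s_pos : 1 ≤ s + r)

/-- Three events of probability `2 exp(-E)` for each of `p` coordinates; `p ≤ p²` puts the bound in
the form of the one for `gramBad`. -/
lemma measureReal_rhoBad_le {t E : ℝ} (ht : 0 < t)
    (h1 : E ≤ 1 / 13824 * (n * (t ^ 2 / M.σ ^ 2)))
    (h2 : E ≤ 1 / 13824 * (n * (t ^ 2 / (M.τ ^ 2 * ((s : ℝ) ^ 2 * M.βmax ^ 2)))))
    (h3 : E ≤ 1 / 13824 * (n * (t ^ 2 / max (M.τ ^ 2) (M.σ ^ 2) ^ 2)))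
    (h4 : E ≤ 1 / 13824 * n) :
    M.P.real (M.rhoBad t) ≤ ((s + r : ℕ) : ℝ) ^ 2 * (6 * Real.exp (-E)) := by
  have := M.isProb
  have hτ := M.τ_pos
  have hσ := M.σ_pos
  have hB := M.βmax_pos
  have hs : (0 : ℝ) < s := by exact_mod_cast M.s_pos
  have hn : (0 : ℝ) < n := by exact_mod_cast M.n_pos
  have hw : ∀ j, M.P.real {ω | t / 3 < |∑ i, M.X i j / n * M.w i ω|} ≤
      2 * Real.exp (-E) := fun j =>
    (measureReal_weighted_sum_le hσ M.w_meas M.indep_w M.w_mean M.w_subG _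
      (M.sum_weight_sq j).le (by positivity)).trans
      (exp_weighted_bound_le hn one_pos hσ ht (by simpa using h1))
  have hA : ∀ j, M.P.real {ω | t / 3 < |∑ i, (M.X *ᵥ M.β) i / n * M.A i ω j|} ≤
      2 * Real.exp (-E) := fun j =>
    (measureReal_weighted_sum_le hτ (fun i => M.A_apply_measurable i j) (M.indep_A j)
      (fun i => M.A_mean i j) (fun i => M.A_apply_subG i j) _ M.sum_mulVec_sq_le
      (by positivity)).trans (exp_weighted_bound_le hn (by positivity) hτ ht h2)
  have hAw : ∀ j, M.P.real {ω | t / 3 < |1 / (n : ℝ) * ∑ i, M.A i ω j * M.w i ω - 0|} ≤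
      2 * Real.exp (-E) := fun j =>
    (measureReal_average_mul_le M.n_pos hτ hσ (fun i => M.A_apply_measurable i j)
      M.w_meas (M.indep_A_mul_w j) (fun i => M.A_apply_subG i j)
      M.w_subG (fun i => M.uncorr i j) (le_max_left _ _) (le_max_right _ _)
      (by positivity)).trans (exp_bound_le (by positivity) hn.le h3 h4)
  have e : M.rhoBad t = ⋃ j, {ω | t < |(M.rhoTilde ω - M.gram *ᵥ M.β) j|} := by
    ext; simp [rhoBad]
  rw [e]
  calc _ ≤ ∑ j, M.P.real {ω | t < |(M.rhoTilde ω - M.gram *ᵥ M.β) j|} :=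
        measureReal_iUnion_fintype_le _
    _ ≤ ∑ _j : Fin s ⊕ Fin r, 6 * Real.exp (-E) := by
        refine Finset.sum_le_sum fun j _ => ?_
        simp only [rhoTilde_sub]
        refine (measureReal_lt_abs_add_le _ _ _ _).trans ?_
        linarith [hw j, hA j, hAw j]
    _ = ((s + r : ℕ) : ℝ) * (6 * Real.exp (-E)) := by
        simp only [Finset.sum_const, Finset.card_univ, Fintype.card_sum, Fintype.card_fin,
          nsmul_eq_mul]
    _ ≤ _ := by
        gcongr
        exact le_self_pow₀ M.one_le_card two_ne_zero

/-- Support recovery, on the event where the plug-in quantities are close to their targets. -/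
lemma forEstimates_of_notMem_bad {lam ε : ℝ} {ω : Ω} (hγ : 0 < M.γ) (hC : 0 < M.Cmin)
    (hlam : 0 < lam) (hε : 0 < ε) (h1 : 4 * ε * linftyNorm M.gramSS⁻¹ ≤ 1)
    (h2 : 32 * ε * linftyNorm M.gramSS⁻¹ ≤ M.γ) (h3 : 32 * ε * M.βmax ≤ M.γ * lam)
    (hG : ω ∉ M.gramBad (ε / s)) (hR : ω ∉ M.rhoBad (M.γ * lam / 16)) :
    M.ForEstimates lam ω fun B => ∃ b, B = {b} ∧
      (∀ j, b (Sum.inr j) = 0) ∧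
      (∀ j, |b (Sum.inl j) - M.βS j| ≤ M.κ * lam) ∧
      (M.κ * lam ≤ M.βmin →
        ∀ j, SignType.sign (b (Sum.inl j)) = SignType.sign (M.βS j)) := by
  refine ⟨exists_isNearestPSD _, fun K hK => ?_⟩
  simp only [gramBad, rhoBad, Set.mem_ofPred_eq, not_exists, not_lt] at hG hR
  obtain ⟨b, hb1, hb2, hb3⟩ := exists_unique_estimate (G := M.gram) (ρ := M.rhoTilde ω)
    (βS := M.βS) M.s_pos hK.1 hlam hε.le (isUnit_det_of_minEigenvalue_pos hC) rfl rfl hγ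
    (hK.abs_sub_le M.gram_posSemidef (by positivity) hG) hR h1 h2 h3
  have hφ := linftyNorm_nonneg M.gram.toBlocks₁₁⁻¹
  have hlt : 3 * linftyNorm M.gram.toBlocks₁₁⁻¹ * lam < M.κ * lam := by
    -- The witness gives `3φ lam`, strictly below `κ lam`; strictness preserves signs even when `κ
    -- lam = βmin`.
    have : 0 < 1 / Real.sqrt M.Cmin := by positivity
    have : M.κ = 4 * linftyNorm M.gram.toBlocks₁₁⁻¹ + 1 / Real.sqrt M.Cmin := rfl
    exact mul_lt_mul_of_pos_right (by linarith) hlam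
  refine ⟨b, hb1, hb2, fun j => (hb3 j).trans hlt.le, fun hκ j => ?_⟩
  have hβ : M.βmin ≤ |M.βS j| := ciInf_le (Set.finite_range _).bddBelow j
  have hclose : |b (Sum.inl j) - M.βS j| < |M.βS j| :=
    (hb3 j).trans_lt (hlt.trans_le (hκ.trans hβ))
  rcases lt_or_gt_of_ne (M.βS_ne j) with h | h
  · rw [abs_of_neg h] at hclose
    rw [sign_neg h, sign_neg (by linarith [(abs_lt.1 hclose).2])]
  · rw [abs_of_pos h] at hclose
    rw [sign_pos h, sign_pos (by linarith [(abs_lt.1 hclose).1])]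

end AdditiveModel

/-! ### Finite-sample theorems with explicit constants -/

/-- Here `3538944 = 256 · 13824`. The spare 256 pays for the squared denominators of the levels `γ
lam / 16`, `lam / 4` and `lam / (8 s B)`. -/
lemma exponent_le {N u v t a : ℝ} (hN : 0 ≤ N) (hv : 0 < v) (ha : 0 < a)
    (h : u * a ≤ 256 * t * v) : 1 / 3538944 * N * u / v ≤ 1 / 13824 * (N * (t / a)) := by
  have h1 : u / v ≤ 256 * (t / a) := by
    rw [mul_div_assoc', div_le_div_iff₀ hv ha]; exact h
  have h2 := mul_le_mul_of_nonneg_left h1 hN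
  have e : 1 / 3538944 * N * u / v = 1 / 3538944 * (N * (u / v)) := by ring
  rw [e]
  linarith

lemma exponent_le_of_le {N u v : ℝ} (hN : 0 ≤ N) (hv : 0 < v) (h : u ≤ 256 * v) :
    1 / 3538944 * N * u / v ≤ 1 / 13824 * N := by
  have := exponent_le (t := 1) (a := 1) hN hv one_pos (by linarith : u * 1 ≤ 256 * 1 * v)
  simpa using this

namespace AdditiveModel

variable {n s r : ℕ} {Ω : Type*} [MeasurableSpace Ω] (M : AdditiveModel n s r Ω)

lemma τ_sq_le_ζ₀ : M.τ ^ 2 ≤ M.ζ₀ := (le_max_left _ _).trans (le_max_left _ _)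

lemma τ_sq_mul_le_ζ₀ : M.τ ^ 2 * M.βmax ^ 2 ≤ M.ζ₀ := (le_max_right _ _).trans (le_max_left _ _)

lemma τ_pow_le_ζ₀ : M.τ ^ 4 ≤ M.ζ₀ := (le_max_left _ _).trans (le_max_right _ _)

lemma σ_pow_le_ζ₀ : M.σ ^ 4 ≤ M.ζ₀ := (le_max_right _ _).trans (le_max_right _ _)

lemma max_sq_le_ζ₀ : max (M.τ ^ 2) (M.σ ^ 2) ^ 2 ≤ M.ζ₀ := by
  rcases max_choice (M.τ ^ 2) (M.σ ^ 2) with h | h <;> rw [h, ← pow_mul]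
  exacts [M.τ_pow_le_ζ₀, M.σ_pow_le_ζ₀]

lemma ζ₀_pos : 0 < M.ζ₀ := (pow_pos M.τ_pos 2).trans_le M.τ_sq_le_ζ₀

lemma ζ₀_le_ζsign : M.ζ₀ ≤ M.ζsign := le_max_left _ _

lemma σ_sq_le_ζsign : M.σ ^ 2 ≤ M.ζsign := le_max_right _ _

lemma ζ₀_le_ζerr : M.ζ₀ ≤ M.ζerr := (le_max_left _ _).trans (le_max_left _ _)

lemma mul_ζ₀_le_ζerr : M.βmax ^ 2 * M.ζ₀ ≤ M.ζerr := (le_max_right _ _).trans (le_max_left _ _)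

lemma σ_sq_le_ζerr : M.σ ^ 2 ≤ M.ζerr := le_max_right _ _

lemma one_le_s (M : AdditiveModel n s r Ω) : (1 : ℝ) ≤ s := by exact_mod_cast M.s_pos

lemma γ_le_one : M.γ ≤ 1 := by
  have := linftyNorm_nonneg (M.gramScS * M.gramSS⁻¹)
  have e : M.γ = 1 - linftyNorm (M.gramScS * M.gramSS⁻¹) := rfl
  linarith

/-- The error bounds, on the event where the plug-in quantities are close to their targets. -/
lemma forEstimates_error_bound {lam ε : ℝ} {ω : Ω} (hRE : 0 < M.RE) (hlam : 0 < lam)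
    (hε : 0 < ε) (hεRE : ε ≤ M.RE / (64 * s)) (hG : ω ∉ M.gramBad ε)
    (hG' : ω ∉ M.gramBad (lam / (8 * s * M.βmax))) (hR : ω ∉ M.rhoBad (lam / 4)) :
    M.ForEstimates lam ω fun B => B.Nonempty ∧ ∀ b ∈ B,
      l2Norm (b - M.β) ≤ 6 * lam * Real.sqrt s / M.RE ∧
      l1Norm (b - M.β) ≤ 24 * lam * s / M.RE := by
  refine ⟨exists_isNearestPSD _, fun K hK => ?_⟩
  simp only [gramBad, rhoBad, Set.mem_ofPred_eq, not_exists, not_lt] at hG hG' hR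
  have hB := M.βmax_pos
  have hs : (0 : ℝ) < s := by exact_mod_cast M.s_pos
  have hKG := hK.abs_sub_le M.gram_posSemidef hε.le hG
  have hKG' := hK.abs_sub_le M.gram_posSemidef (by positivity) hG'
  -- `lam / 4` comes from `rhoTilde`, and `lam / 4` from the error of `K` applied to `β`, since
  -- `‖β‖₁ ≤ s B`; hence the level `lam / (8 s B)`.
  have hρ : ∀ j, |(M.rhoTilde ω - K *ᵥ M.β) j| ≤ lam / 2 := fun j => by
    have e : (M.rhoTilde ω - K *ᵥ M.β) j =
        (M.rhoTilde ω - M.gram *ᵥ M.β) j - ((K - M.gram) *ᵥ M.β) j := by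
      rw [Matrix.sub_mulVec]; simp only [Pi.sub_apply]; ring
    have h1 : |((K - M.gram) *ᵥ M.β) j| ≤ 2 * (lam / (8 * s * M.βmax)) * l1Norm M.β :=
      abs_dotProduct_le (hKG' j)
    have h2 : l1Norm M.β ≤ s * M.βmax := by
      rw [l1Norm_sum_type]
      simp only [β, Sum.elim_inl, Sum.elim_inr, l1Norm, Pi.zero_apply, abs_zero,
        Finset.sum_const_zero, add_zero]
      calc ∑ j, |M.βS j| ≤ ∑ _j : Fin s, M.βmax :=
            Finset.sum_le_sum fun j _ => norm_le_pi_norm M.βS j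
        _ = _ := by rw [Finset.sum_const, Finset.card_univ, Fintype.card_fin, nsmul_eq_mul]
    have h3 : 2 * (lam / (8 * s * M.βmax)) * (s * M.βmax) = lam / 4 := by field
    have h4 : 2 * (lam / (8 * s * M.βmax)) * l1Norm M.β ≤
        2 * (lam / (8 * s * M.βmax)) * (s * M.βmax) := by gcongr
    rw [e]
    refine (abs_sub _ _).trans ?_
    linarith [hR j]
  refine ⟨exists_isEstimate hK.1 hlam M.β hρ, fun b hb => ?_⟩
  exact IsEstimate.error_bound M.s_pos M.gram_posSemidef hK.1 hlam hε.le hRE hεRE hKG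
    (fun j => rfl) hρ hb

/-- Three bad events are excluded. The Gram matrix must be accurate to `lam / (8 s B)` for the
gradient at `β`, which brings `B² ζ₀` into `ζerr`, and to `ε` for the curvature. -/
theorem error_bounds {lam ε : ℝ} (hRE : 0 < M.RE) (hlam : 0 < lam)
    (hlam' : lam ≤ min (1 / 3538944 * M.τ ^ 2) (12 * (1 / 3538944 * M.τ ^ 2) * M.βmax))
    (hε : 0 < ε) (hε' : ε ≤ min (1 / 3538944 * M.τ ^ 2) (M.RE / (64 * s))) :
    HoldsWithProb M.P
      (1 - ((s + r : ℕ) : ℝ) ^ 2 * 24 *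
          Real.exp (-(1 / 3538944 * n * lam ^ 2 / (s ^ 2 * M.ζerr)))
        - ((s + r : ℕ) : ℝ) ^ 2 * 24 * Real.exp (-(1 / 3538944 * n * ε ^ 2 / M.ζerr)))
      (fun ω => M.ForEstimates lam ω fun B =>
        B.Nonempty ∧ ∀ b ∈ B,
          l2Norm (b - M.β) ≤ 24 * lam * Real.sqrt s / M.RE ∧
          l1Norm (b - M.β) ≤ 24 * lam * s / M.RE) := by
  have := M.isProb
  have hτ := M.τ_pos
  have hσ := M.σ_pos
  have hB := M.βmax_pos
  have hs1 := M.one_le_s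
  have hs : (0 : ℝ) < s := one_pos.trans_le hs1
  have hn : (0 : ℝ) ≤ n := Nat.cast_nonneg n
  have hζ0 := M.ζ₀_le_ζerr
  have hζ : 0 < M.ζerr := M.ζ₀_pos.trans_le hζ0
  have hs2 : (1 : ℝ) ≤ (s : ℝ) ^ 2 := one_le_pow₀ hs1
  have hsζ : M.ζerr ≤ s ^ 2 * M.ζerr := le_mul_of_one_le_left hζ.le hs2
  have hv : 0 < (s : ℝ) ^ 2 * M.ζerr := by positivity
  have hτB : M.τ ^ 2 * M.βmax ^ 2 ≤ M.ζerr := M.τ_sq_mul_le_ζ₀.trans hζ0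
  have hτB4 : M.βmax ^ 2 * M.τ ^ 4 ≤ M.ζerr :=
    (mul_le_mul_of_nonneg_left M.τ_pow_le_ζ₀ (sq_nonneg _)).trans M.mul_ζ₀_le_ζerr
  have hmax := M.max_sq_le_ζ₀.trans hζ0
  obtain ⟨hl1, hl2⟩ := le_min_iff.1 hlam'
  obtain ⟨he1, he2⟩ := le_min_iff.1 hε'
  set t := lam / (8 * s * M.βmax) with ht
  have ht0 : 0 < t := by positivity
  have htl : lam = 8 * s * M.βmax * t := by rw [ht]; field
  -- Bernstein's exponent saturates at a multiple of `n`. The cap on `lam`, through this bound,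
  -- keeps the required exponent below saturation; the cap on `ε` does the same below.
  have hlamB : lam ^ 2 ≤ M.βmax ^ 2 * M.τ ^ 4 := by
    have h0 : 0 < M.τ ^ 2 * M.βmax := by positivity
    have h1 : lam ≤ M.τ ^ 2 * M.βmax := by linarith
    calc lam ^ 2 ≤ (M.τ ^ 2 * M.βmax) ^ 2 := by gcongr
      _ = _ := by ring
  have hcap : 1 / 3538944 * n * lam ^ 2 / (s ^ 2 * M.ζerr) ≤ 1 / 13824 * n :=
    exponent_le_of_le hn hv (by linarith)
  have hε2 : ε ^ 2 ≤ M.τ ^ 4 := by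
    have h1 : ε ≤ M.τ ^ 2 := by linarith [sq_nonneg M.τ]
    calc ε ^ 2 ≤ (M.τ ^ 2) ^ 2 := by gcongr
      _ = _ := by ring
  have hb1 := M.measureReal_gramBad_le (t := t)
    (E := 1 / 3538944 * n * lam ^ 2 / (s ^ 2 * M.ζerr)) ht0
    (exponent_le hn hv (by positivity) (by
      have := mul_le_mul_of_nonneg_left hτB (by positivity : 0 ≤ (s : ℝ) ^ 2 * t ^ 2)
      have h0 : 0 ≤ (s : ℝ) ^ 2 * t ^ 2 * M.ζerr := by positivity
      rw [htl]; linarith))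
    (exponent_le hn hv (by positivity) (by
      have := mul_le_mul_of_nonneg_left hτB4 (by positivity : 0 ≤ (s : ℝ) ^ 2 * t ^ 2)
      have h0 : 0 ≤ (s : ℝ) ^ 2 * t ^ 2 * M.ζerr := by positivity
      rw [htl]; linarith)) hcap
  have hb2 := M.measureReal_gramBad_le (t := ε) (E := 1 / 3538944 * n * ε ^ 2 / M.ζerr) hε
    (exponent_le hn hζ (by positivity) (by
      have := mul_le_mul_of_nonneg_left (M.τ_sq_le_ζ₀.trans hζ0) (sq_nonneg ε)
      have h0 : 0 ≤ ε ^ 2 * M.ζerr := by positivity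
      linarith))
    (exponent_le hn hζ (by positivity) (by
      have := mul_le_mul_of_nonneg_left (M.τ_pow_le_ζ₀.trans hζ0) (sq_nonneg ε)
      have h0 : 0 ≤ ε ^ 2 * M.ζerr := by positivity
      linarith))
    (exponent_le_of_le hn hζ (by linarith [M.τ_pow_le_ζ₀]))
  have hb3 := M.measureReal_rhoBad_le (t := lam / 4)
    (E := 1 / 3538944 * n * lam ^ 2 / (s ^ 2 * M.ζerr)) (by positivity)
    (exponent_le hn hv (by positivity) (by
      have := mul_le_mul_of_nonneg_left (M.σ_sq_le_ζerr.trans hsζ) (sq_nonneg lam)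
      have h0 : 0 ≤ lam ^ 2 * (s ^ 2 * M.ζerr) := by positivity
      linarith))
    (exponent_le hn hv (by positivity) (by
      have := mul_le_mul_of_nonneg_left hτB (by positivity : 0 ≤ lam ^ 2 * (s : ℝ) ^ 2)
      have h0 : 0 ≤ lam ^ 2 * (s ^ 2 * M.ζerr) := by positivity
      linarith))
    (exponent_le hn hv (by positivity) (by
      have := mul_le_mul_of_nonneg_left (hmax.trans hsζ) (sq_nonneg lam)
      have h0 : 0 ≤ lam ^ 2 * (s ^ 2 * M.ζerr) := by positivity
      linarith)) hcap
  rw [sub_sub]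
  refine holdsWithProb_one_sub (N := (M.gramBad t ∪ M.gramBad ε) ∪ M.rhoBad (lam / 4))
    (((M.measurableSet_gramBad _).union (M.measurableSet_gramBad _)).union
      (M.measurableSet_rhoBad _)) ?_ fun ω hω => ?_
  · have h1 := measureReal_union_le (μ := M.P) (M.gramBad t ∪ M.gramBad ε) (M.rhoBad (lam / 4))
    have h2 := measureReal_union_le (μ := M.P) (M.gramBad t) (M.gramBad ε)
    have h3 : 0 ≤ ((s + r : ℕ) : ℝ) ^ 2 *
        Real.exp (-(1 / 3538944 * n * lam ^ 2 / (s ^ 2 * M.ζerr))) := by positivity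
    have h4 : 0 ≤ ((s + r : ℕ) : ℝ) ^ 2 *
        Real.exp (-(1 / 3538944 * n * ε ^ 2 / M.ζerr)) := by positivity
    linarith
  · simp only [Set.mem_union, not_or] at hω
    have h := M.forEstimates_error_bound hRE hlam hε he2 hω.1.2 hω.1.1 hω.2
    refine ⟨h.1, fun K hK => ⟨(h.2 K hK).1, fun b hb => ⟨((h.2 K hK).2 b hb).1.trans ?_,
      ((h.2 K hK).2 b hb).2⟩⟩⟩
    gcongr
    norm_num

/-- Support recovery with explicit conditions on the constants and the exponents. -/
theorem support_recovery_of_exponents {lam ε E₁ E₂ : ℝ} (hγ : 0 < M.γ) (hC : 0 < M.Cmin)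
    (hlam : 0 < lam) (hε : 0 < ε) (hφ : 32 * ε * linftyNorm M.gramSS⁻¹ ≤ M.γ)
    (hβ : 32 * ε * M.βmax ≤ M.γ * lam)
    (h1 : E₁ ≤ 1 / 13824 * (n * ((M.γ * lam / 16) ^ 2 / M.σ ^ 2)))
    (h2 : E₁ ≤ 1 / 13824 *
      (n * ((M.γ * lam / 16) ^ 2 / (M.τ ^ 2 * ((s : ℝ) ^ 2 * M.βmax ^ 2)))))
    (h3 : E₁ ≤ 1 / 13824 * (n * ((M.γ * lam / 16) ^ 2 / max (M.τ ^ 2) (M.σ ^ 2) ^ 2)))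
    (h4 : E₁ ≤ 1 / 13824 * n)
    (h5 : E₂ ≤ 1 / 13824 * (n * ((ε / s) ^ 2 / M.τ ^ 2)))
    (h6 : E₂ ≤ 1 / 13824 * (n * ((ε / s) ^ 2 / M.τ ^ 4))) (h7 : E₂ ≤ 1 / 13824 * n) :
    HoldsWithProb M.P
      (1 - (((s + r : ℕ) : ℝ) ^ 2 * 24 * Real.exp (-E₁)
        + ((s + r : ℕ) : ℝ) ^ 2 * 24 * Real.exp (-E₂)))
      (fun ω => M.ForEstimates lam ω fun B => ∃ b, B = {b} ∧
        (∀ j, b (Sum.inr j) = 0) ∧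
        (∀ j, |b (Sum.inl j) - M.βS j| ≤ M.κ * lam) ∧
        (M.κ * lam ≤ M.βmin →
          ∀ j, SignType.sign (b (Sum.inl j)) = SignType.sign (M.βS j))) := by
  have := M.isProb
  have hs : (0 : ℝ) < s := by exact_mod_cast M.s_pos
  have hb1 := M.measureReal_rhoBad_le (by positivity) h1 h2 h3 h4
  have hb2 := M.measureReal_gramBad_le (by positivity) h5 h6 h7
  refine holdsWithProb_one_sub (N := M.rhoBad (M.γ * lam / 16) ∪ M.gramBad (ε / s))
    ((M.measurableSet_rhoBad _).union (M.measurableSet_gramBad _)) ?_ fun ω hω => ?_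
  · have h8 := measureReal_union_le (μ := M.P) (M.rhoBad (M.γ * lam / 16)) (M.gramBad (ε / s))
    have h9 : 0 ≤ ((s + r : ℕ) : ℝ) ^ 2 * Real.exp (-E₁) := by positivity
    have h10 : 0 ≤ ((s + r : ℕ) : ℝ) ^ 2 * Real.exp (-E₂) := by positivity
    linarith
  · simp only [Set.mem_union, not_or] at hω
    exact M.forEstimates_of_notMem_bad hγ hC hlam hε (by linarith [M.γ_le_one]) hφ hβ hω.2 hω.1

theorem support_recovery {lam ε : ℝ} (hγ : 0 < M.γ) (hC : 0 < M.Cmin) (hlam : 0 < lam)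
    (hlam' : lam ≤ 4 * (1 / 3538944 * M.τ ^ 2) / M.γ) (hε : 0 < ε)
    (hετ : ε ≤ 1 / 3538944 * M.τ ^ 2) (hφ : 32 * ε * linftyNorm M.gramSS⁻¹ ≤ M.γ)
    (hβ : 32 * ε * M.βmax ≤ M.γ * lam) :
    HoldsWithProb M.P
      (1 - (((s + r : ℕ) : ℝ) ^ 2 * 24 *
            Real.exp (-(1 / 3538944 * n * M.γ ^ 2 * lam ^ 2 / (s ^ 2 * M.ζsign)))
        + ((s + r : ℕ) : ℝ) ^ 2 * 24 *
            Real.exp (-(1 / 3538944 * n * ε ^ 2 / (s ^ 2 * M.ζsign)))))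
      (fun ω => M.ForEstimates lam ω fun B => ∃ b, B = {b} ∧
        (∀ j, b (Sum.inr j) = 0) ∧
        (∀ j, |b (Sum.inl j) - M.βS j| ≤ M.κ * lam) ∧
        (M.κ * lam ≤ M.βmin →
          ∀ j, SignType.sign (b (Sum.inl j)) = SignType.sign (M.βS j))) := by
  have hτ := M.τ_pos
  have hσ := M.σ_pos
  have hB := M.βmax_pos
  have hs1 := M.one_le_s
  have hs : (0 : ℝ) < s := one_pos.trans_le hs1
  have hn : (0 : ℝ) ≤ n := Nat.cast_nonneg n
  have hζ0 := M.ζ₀_le_ζsign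
  have hζ : 0 < M.ζsign := M.ζ₀_pos.trans_le hζ0
  have hsζ : M.ζsign ≤ s ^ 2 * M.ζsign := le_mul_of_one_le_left hζ.le (one_le_pow₀ hs1)
  have hv : 0 < (s : ℝ) ^ 2 * M.ζsign := by positivity
  have hsq : ∀ x : ℝ, 0 ≤ x → x ≤ M.τ ^ 2 → x ^ 2 ≤ 256 * (s ^ 2 * M.ζsign) := fun x h0 hx => by
    have : x ^ 2 ≤ M.τ ^ 4 := by
      calc x ^ 2 ≤ (M.τ ^ 2) ^ 2 := by gcongr
        _ = _ := by ring
    linarith [M.τ_pow_le_ζ₀]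
  have hγlam : M.γ * lam ≤ M.τ ^ 2 := by
    rw [le_div_iff₀ hγ] at hlam'
    linarith [sq_nonneg M.τ]
  have e1 : 1 / 3538944 * n * M.γ ^ 2 * lam ^ 2 / (s ^ 2 * M.ζsign) =
      1 / 3538944 * n * (M.γ * lam) ^ 2 / (s ^ 2 * M.ζsign) := by ring
  have e2 : 256 * (ε / s) ^ 2 * (s ^ 2 * M.ζsign) = 256 * (ε ^ 2 * M.ζsign) := by field
  rw [e1]
  refine M.support_recovery_of_exponents hγ hC hlam hε hφ hβ
    (exponent_le hn hv (by positivity) ?_) (exponent_le hn hv (by positivity) ?_)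
    (exponent_le hn hv (by positivity) ?_) (exponent_le_of_le hn hv (hsq _ (by positivity) hγlam))
    (exponent_le hn hv (by positivity) ?_) (exponent_le hn hv (by positivity) ?_)
    (exponent_le_of_le hn hv (hsq _ hε.le (by linarith [sq_nonneg M.τ])))
  · have := mul_le_mul_of_nonneg_left (M.σ_sq_le_ζsign.trans hsζ) (sq_nonneg (M.γ * lam))
    linarith
  · have := mul_le_mul_of_nonneg_left (M.τ_sq_mul_le_ζ₀.trans hζ0)
      (by positivity : 0 ≤ (M.γ * lam) ^ 2 * (s : ℝ) ^ 2)
    linarith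
  · have := mul_le_mul_of_nonneg_left ((M.max_sq_le_ζ₀.trans hζ0).trans hsζ)
      (sq_nonneg (M.γ * lam))
    linarith
  · have := mul_le_mul_of_nonneg_left (M.τ_sq_le_ζ₀.trans hζ0) (sq_nonneg ε)
    have h0 : 0 ≤ ε ^ 2 * M.ζsign := by positivity
    linarith
  · have := mul_le_mul_of_nonneg_left (M.τ_pow_le_ζ₀.trans hζ0) (sq_nonneg ε)
    have h0 : 0 ≤ ε ^ 2 * M.ζsign := by positivity
    linarith

end AdditiveModel

/-! ### Asymptotic sign consistency -/

namespace AdditiveModel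

variable {n s r : ℕ} {Ω : Type*} [MeasurableSpace Ω] (M : AdditiveModel n s r Ω)

lemma linftyNorm_inv_le_κ : linftyNorm M.gramSS⁻¹ ≤ M.κ := by
  have h1 := linftyNorm_nonneg M.gramSS⁻¹
  have h2 : 0 ≤ 1 / Real.sqrt M.Cmin := by positivity
  have e : M.κ = 4 * linftyNorm M.gramSS⁻¹ + 1 / Real.sqrt M.Cmin := rfl
  linarith

/-- Support recovery with probability close to one, under bounds of `γ`, `τ` and `κ`. -/
lemma support_recovery_of_bounds {lam γ₀ T k₀ μ l : ℝ} (hγ₀ : 0 < γ₀) (hγ : γ₀ ≤ M.γ)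
    (hC : 0 < M.Cmin) (hT : 1 ≤ T) (hτT : M.τ ≤ T) (hk : M.κ ≤ k₀) (hlam : 0 < lam)
    (hl : 0 ≤ l) (hμ : 3 * (μ * ((k₀ + 1) ^ 2 * T ^ 4)) = 1 / 13824 / 1024 * γ₀ ^ 2)
    (h1 : s ^ 2 * l ≤ μ * n) (h2 : s ^ 2 * (M.ζsign * l) ≤ μ * (n * lam ^ 2)) :
    HoldsWithProb M.P
      (1 - (((s + r : ℕ) : ℝ) ^ 2 * 24 * Real.exp (-(3 * l))
        + ((s + r : ℕ) : ℝ) ^ 2 * 24 * Real.exp (-(3 * l))))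
      (fun ω => M.ForEstimates lam ω fun B => ∃ b, B = {b} ∧
        (∀ j, b (Sum.inr j) = 0) ∧
        (∀ j, |b (Sum.inl j) - M.βS j| ≤ M.κ * lam) ∧
        (M.κ * lam ≤ M.βmin →
          ∀ j, SignType.sign (b (Sum.inl j)) = SignType.sign (M.βS j))) := by
  have hτ := M.τ_pos
  have hσ := M.σ_pos
  have hB := M.βmax_pos
  have hs1 := M.one_le_s
  have hs : (0 : ℝ) < s := one_pos.trans_le hs1
  have hs2 : (1 : ℝ) ≤ (s : ℝ) ^ 2 := one_le_pow₀ hs1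
  have hn : (0 : ℝ) ≤ n := Nat.cast_nonneg n
  have hζ0 := M.ζ₀_le_ζsign
  have hζ : 0 < M.ζsign := M.ζ₀_pos.trans_le hζ0
  have hsζ : M.ζsign ≤ s ^ 2 * M.ζsign := le_mul_of_one_le_left hζ.le hs2
  have hγ' : 0 < M.γ := hγ₀.trans_le hγ
  set φ := linftyNorm M.gramSS⁻¹ with hφdef
  have hφ0 : 0 ≤ φ := linftyNorm_nonneg _
  have hφk : φ + 1 ≤ k₀ + 1 := by linarith [M.linftyNorm_inv_le_κ]
  have hk1 : 1 ≤ (k₀ + 1) ^ 2 := one_le_pow₀ (by linarith)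
  have hT2 : 1 ≤ T ^ 2 := one_le_pow₀ hT
  have hT24 : T ^ 2 ≤ T ^ 4 := pow_le_pow_right₀ hT (by norm_num)
  have hTk : T ^ 4 ≤ (k₀ + 1) ^ 2 * T ^ 4 := le_mul_of_one_le_left (by positivity) hk1
  set Y := (k₀ + 1) ^ 2 * T ^ 4 with hY
  have hY1 : 1 ≤ Y := by linarith
  have hγsq : γ₀ ^ 2 ≤ M.γ ^ 2 := by gcongr
  -- `μ` is chosen so that the assumed rates yield exponents `3l`; `1024 = 32²` comes from the
  -- denominators of `t₁` and `t₂` below, and `Y` dominates the bounded quantities.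
  have hF1 : 3 * (s ^ 2 * l) * Y ≤ 1 / 13824 * (n * (M.γ ^ 2 / 1024)) := by
    have a1 := mul_le_mul_of_nonneg_right h1 (by positivity : 0 ≤ Y)
    have a2 := congrArg (fun x => x * (n : ℝ)) hμ
    have a3 := mul_le_mul_of_nonneg_left hγsq hn
    linarith
  have hF2 : 3 * (s ^ 2 * (M.ζsign * l)) * Y ≤ 1 / 13824 * (n * ((M.γ * lam) ^ 2 / 1024)) := by
    have a1 := mul_le_mul_of_nonneg_right h2 (by positivity : 0 ≤ Y)
    have a2 := congrArg (fun x => x * (n * lam ^ 2)) hμ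
    have a3 := mul_le_mul_of_nonneg_left hγsq (by positivity : 0 ≤ n * lam ^ 2)
    linarith
  have hdiv : ∀ t a : ℝ, 0 < a → 3 * l * a ≤ 1 / 13824 * (n * t) →
      3 * l ≤ 1 / 13824 * (n * (t / a)) := fun t a ha h => by
    rw [mul_div_assoc', mul_div_assoc', le_div_iff₀ ha]; exact h
  have hcap : 3 * l ≤ 1 / 13824 * n := by
    have a1 : l ≤ s ^ 2 * l := le_mul_of_one_le_left hl hs2
    have a2 : s ^ 2 * l ≤ s ^ 2 * l * Y := le_mul_of_one_le_right (by positivity) hY1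
    have a3 : M.γ ^ 2 ≤ 1 := pow_le_one₀ hγ'.le M.γ_le_one
    have a4 := mul_le_mul_of_nonneg_left a3 hn
    linarith
  have hlY : ∀ a : ℝ, a ≤ s ^ 2 * M.ζsign →
      3 * l * a ≤ 1 / 13824 * (n * (M.γ * lam / 16) ^ 2) := fun a ha => by
    have a1 := mul_le_mul_of_nonneg_left ha hl
    have a2 : s ^ 2 * (M.ζsign * l) ≤ s ^ 2 * (M.ζsign * l) * Y :=
      le_mul_of_one_le_right (by positivity) hY1
    have a3 : 0 ≤ n * (M.γ * lam) ^ 2 := by positivity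
    linarith
  -- `t₁` is the largest `ε` allowed by the condition on `βmax`; `t₂` is admissible for the one on
  -- `φ`, with `φ + 1` keeping the denominator positive. Taking `ε = min t₁ t₂` requires the
  -- deviation bounds for both.
  set t₁ := M.γ * lam / (32 * M.βmax) with ht₁
  set t₂ := M.γ / (32 * (φ + 1)) with ht₂
  have htau : ∀ a t : ℝ, a = M.τ ^ 2 ∨ a = M.τ ^ 4 → t = t₁ ∨ t = t₂ →
      3 * l ≤ 1 / 13824 * (n * ((t / s) ^ 2 / a)) := by
    intro a t ha ht
    have ha0 : 0 < a := by rcases ha with rfl | rfl <;> positivity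
    have haT : a ≤ T ^ 4 := by
      rcases ha with rfl | rfl
      · exact (pow_le_pow_left₀ hτ.le hτT 2).trans hT24
      · exact pow_le_pow_left₀ hτ.le hτT 4
    rcases ht with rfl | rfl
    · have e : n * ((t₁ / s) ^ 2 / a) =
          n * ((M.γ * lam) ^ 2 / 1024 / (a * (M.βmax ^ 2 * s ^ 2))) := by
        rw [ht₁]; field
      rw [e]
      refine hdiv _ _ (by positivity) (le_trans ?_ hF2)
      -- `ζ₀` controls `τ² B²` only; for `a = τ⁴` the extra `τ²` is bounded by `T² ≤ Y`.
      have hζa : a * M.βmax ^ 2 ≤ M.ζsign * Y := by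
        rcases ha with rfl | rfl
        · exact (M.τ_sq_mul_le_ζ₀.trans hζ0).trans (le_mul_of_one_le_right hζ.le hY1)
        · calc M.τ ^ 4 * M.βmax ^ 2 = M.τ ^ 2 * M.βmax ^ 2 * M.τ ^ 2 := by ring
            _ ≤ M.ζsign * Y := by
              gcongr
              · exact M.τ_sq_mul_le_ζ₀.trans hζ0
              · exact (pow_le_pow_left₀ hτ.le hτT 2).trans (hT24.trans hTk)
      have := mul_le_mul_of_nonneg_left hζa (by positivity : 0 ≤ 3 * l * (s : ℝ) ^ 2)
      linarith
    · have e : n * ((t₂ / s) ^ 2 / a) =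
          n * (M.γ ^ 2 / 1024 / (a * ((φ + 1) ^ 2 * s ^ 2))) := by
        rw [ht₂]; field
      rw [e]
      refine hdiv _ _ (by positivity) (le_trans ?_ hF1)
      have hYa : (φ + 1) ^ 2 * a ≤ Y := by rw [hY]; gcongr
      have := mul_le_mul_of_nonneg_left hYa (by positivity : 0 ≤ 3 * l * (s : ℝ) ^ 2)
      linarith
  have hmin := min_choice t₁ t₂
  refine M.support_recovery_of_exponents (ε := min t₁ t₂) hγ' hC hlam
    (lt_min (by positivity) (by positivity)) ?_ ?_
    (hdiv _ _ (by positivity) (hlY _ (M.σ_sq_le_ζsign.trans hsζ)))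
    (hdiv _ _ (by positivity) (hlY _ ?_))
    (hdiv _ _ (by positivity) (hlY _ ((M.max_sq_le_ζ₀.trans hζ0).trans hsζ))) hcap
    (htau _ _ (Or.inl rfl) hmin) (htau _ _ (Or.inr rfl) hmin) hcap
  · calc 32 * min t₁ t₂ * φ ≤ 32 * t₂ * (φ + 1) := by
          have : 0 < t₁ := by positivity
          have : 0 < t₂ := by positivity
          gcongr
          · exact min_le_right _ _
          · linarith
      _ = M.γ := by rw [ht₂]; field
  · calc 32 * min t₁ t₂ * M.βmax ≤ 32 * t₁ * M.βmax := by
          gcongr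
          exact min_le_left _ _
      _ = M.γ * lam := by rw [ht₁]; field
  · have := mul_le_mul_of_nonneg_left (M.τ_sq_mul_le_ζ₀.trans hζ0) (by positivity : 0 ≤ (s : ℝ) ^ 2)
    linarith

end AdditiveModel

theorem sign_consistency (n s r : ℕ → ℕ) (Ω : ℕ → Type*) [∀ k, MeasurableSpace (Ω k)]
    (M : ∀ k, AdditiveModel (n k) (s k) (r k) (Ω k)) (lam : ℕ → ℝ)
    (hC : ∀ k, 0 < (M k).Cmin) (hlam : ∀ k, 0 < lam k)
    (hγ : ∃ γ₀ : ℝ, 0 < γ₀ ∧ ∀ᶠ k in atTop, γ₀ ≤ (M k).γ)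
    (hτ : (fun k => (M k).τ) =O[atTop] (fun _ => (1 : ℝ)))
    (hκ : (fun k => (M k).κ) =O[atTop] (fun _ => (1 : ℝ)))
    (hp : Tendsto (fun k => s k + r k) atTop atTop)
    (hsn : Tendsto (fun k => (s k : ℝ) ^ 2 * Real.log ((s k + r k : ℕ) : ℝ) / n k) atTop (𝓝 0))
    (hlamβ : lam =o[atTop] (fun k => (M k).βmin))
    (hζlam : (fun k => s k * Real.sqrt ((M k).ζsign * Real.log ((s k + r k : ℕ) : ℝ) / n k))
      =o[atTop] lam) :
    ∃ q : ℕ → ℝ, Tendsto q atTop (𝓝 1) ∧ ∀ k,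
      HoldsWithProb (M k).P (q k) (fun ω => (M k).ForEstimates (lam k) ω fun B =>
        ∃ b, B = {b} ∧
          (∀ j, SignType.sign (b j) = SignType.sign ((M k).β j)) ∧
          (∀ j, |b (Sum.inl j) - (M k).βS j| ≤ (M k).κ * lam k)) := by
  classical
  obtain ⟨γ₀, hγ₀, hγ⟩ := hγ
  obtain ⟨T, hT1, hT⟩ : ∃ T : ℝ, 1 ≤ T ∧ ∀ᶠ k in atTop, (M k).τ ≤ T := by
    obtain ⟨c, hc⟩ := hτ.bound
    refine ⟨max c 1, le_max_right _ _, hc.mono fun k hk => ?_⟩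
    rw [norm_one, mul_one] at hk
    exact (Real.le_norm_self _).trans (hk.trans (le_max_left _ _))
  obtain ⟨k₀, hk1, hk₀⟩ : ∃ k₀ : ℝ, 1 ≤ k₀ ∧ ∀ᶠ k in atTop, (M k).κ ≤ k₀ := by
    obtain ⟨c, hc⟩ := hκ.bound
    refine ⟨max c 1, le_max_right _ _, hc.mono fun k hk => ?_⟩
    rw [norm_one, mul_one] at hk
    exact (Real.le_norm_self _).trans (hk.trans (le_max_left _ _))
  set μ := 1 / 13824 / 1024 * γ₀ ^ 2 / (3 * ((k₀ + 1) ^ 2 * T ^ 4)) with hμdef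
  have hμ0 : 0 < μ := by positivity
  have hμ : 3 * (μ * ((k₀ + 1) ^ 2 * T ^ 4)) = 1 / 13824 / 1024 * γ₀ ^ 2 := by
    rw [hμdef]; field
  set l : ℕ → ℝ := fun k => Real.log ((s k + r k : ℕ) : ℝ) with hldef
  have hl0 : ∀ k, 0 ≤ l k := fun k => Real.log_natCast_nonneg _
  -- All that the finite-sample bound needs at an index. It holds eventually; at other indices the
  -- trivial probability 0 is claimed.
  set good : ℕ → Prop := fun k => γ₀ ≤ (M k).γ ∧ (M k).τ ≤ T ∧ (M k).κ ≤ k₀ ∧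
    (s k : ℝ) ^ 2 * l k ≤ μ * n k ∧
    (s k : ℝ) ^ 2 * ((M k).ζsign * l k) ≤ μ * (n k * lam k ^ 2) ∧
    (M k).κ * lam k ≤ (M k).βmin with hgood
  have hn0 : ∀ k, (0 : ℝ) < n k := fun k => by exact_mod_cast (M k).n_pos
  have hgood_ev : ∀ᶠ k in atTop, good k := by
    have e1 : ∀ᶠ k in atTop, (s k : ℝ) ^ 2 * l k ≤ μ * n k := by
      filter_upwards [hsn.eventually_le_const hμ0] with k hk
      rwa [div_le_iff₀ (hn0 k)] at hk
    have e2 : ∀ᶠ k in atTop,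
        (s k : ℝ) ^ 2 * ((M k).ζsign * l k) ≤ μ * (n k * lam k ^ 2) := by
      filter_upwards [hζlam.bound (Real.sqrt_pos.2 hμ0)] with k hk
      have hζ : 0 < (M k).ζsign := (M k).ζ₀_pos.trans_le (M k).ζ₀_le_ζsign
      have hx : 0 ≤ (M k).ζsign * l k / n k :=
        div_nonneg (mul_nonneg hζ.le (hl0 k)) (hn0 k).le
      have h := pow_le_pow_left₀ (norm_nonneg _) hk 2
      rw [mul_pow, Real.norm_eq_abs, Real.norm_eq_abs, sq_abs, sq_abs, mul_pow,
        Real.sq_sqrt hμ0.le, Real.sq_sqrt hx, mul_div_assoc', div_le_iff₀ (hn0 k)] at h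
      linarith
    have e3 : ∀ᶠ k in atTop, (M k).κ * lam k ≤ (M k).βmin := by
      have hk0 : 0 < k₀ := by linarith
      filter_upwards [hlamβ.bound (inv_pos.2 hk0), hk₀] with k hk hκk
      have hβ : 0 ≤ (M k).βmin := Real.iInf_nonneg fun _ => abs_nonneg _
      rw [Real.norm_eq_abs, Real.norm_eq_abs, abs_of_pos (hlam k), abs_of_nonneg hβ] at hk
      calc (M k).κ * lam k ≤ k₀ * (k₀⁻¹ * (M k).βmin) := by
            have := (hlam k).le
            gcongr
        _ = (M k).βmin := by field
    filter_upwards [hγ, hT, hk₀, e1, e2, e3] with k a1 a2 a3 a4 a5 a6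
    exact ⟨a1, a2, a3, a4, a5, a6⟩
  refine ⟨fun k => if good k then 1 - (((s k + r k : ℕ) : ℝ) ^ 2 * 24 * Real.exp (-(3 * l k))
    + ((s k + r k : ℕ) : ℝ) ^ 2 * 24 * Real.exp (-(3 * l k))) else 0, ?_, fun k => ?_⟩
  · have hlim : Tendsto (fun k => 1 - 48 * ((s k + r k : ℕ) : ℝ)⁻¹) atTop (𝓝 1) := by
      have h := (tendsto_inv_atTop_zero.comp
        ((tendsto_natCast_atTop_atTop (R := ℝ)).comp hp)).const_mul 48
      simpa using h.const_sub 1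
    refine hlim.congr' (hgood_ev.mono fun k hk => ?_)
    have hpos : (0 : ℝ) < ((s k + r k : ℕ) : ℝ) := one_pos.trans_le (M k).one_le_card
    -- With `l = log p`, each exponential is `p⁻³`, and the union bound leaves `48 / p`.
    have hexp : Real.exp (-(3 * l k)) = (((s k + r k : ℕ) : ℝ) ^ 3)⁻¹ := by
      rw [Real.exp_neg, mul_comm, Real.exp_mul, hldef, Real.exp_log hpos]
      norm_num
    beta_reduce
    rw [if_pos hk, hexp]
    field
  · by_cases hk : good k
    · simp only [if_pos hk]
      obtain ⟨a1, a2, a3, a4, a5, a6⟩ := hk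
      obtain ⟨E, hE, hq, hQ⟩ := (M k).support_recovery_of_bounds hγ₀ a1 (hC k) hT1 a2 a3 (hlam k)
        (hl0 k) hμ a4 a5
      refine ⟨E, hE, hq, fun ω hω => ⟨(hQ ω hω).1, fun K hK => ?_⟩⟩
      obtain ⟨b, hb1, hb2, hb3, hb4⟩ := (hQ ω hω).2 K hK
      refine ⟨b, hb1, ?_, hb3⟩
      rintro (j | j)
      · exact hb4 a6 j
      · rw [hb2]; rfl
    · simp only [if_neg hk]
      exact holdsWithProb_zero _ _

end CoCoLasso

end

/-! ### The corollary -/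

open CoCoLasso

theorem mainTheorem5 :
    (∃ C c : ℝ, 0 < C ∧ 0 < c ∧
      -- error bounds under the restricted eigenvalue condition
      (∀ (n s r : ℕ) (Ω : Type*) [MeasurableSpace Ω] (M : AdditiveModel n s r Ω) (lam ε : ℝ),
        0 < M.RE →
        0 < lam → lam ≤ min (c * M.τ ^ 2) (12 * (c * M.τ ^ 2) * M.βmax) →
        0 < ε → ε ≤ min (c * M.τ ^ 2) (M.RE / (64 * s)) →
        HoldsWithProb M.P
          (1 - ((s + r : ℕ) : ℝ) ^ 2 * C * Real.exp (-(c * n * lam ^ 2 / (s ^ 2 * M.ζerr)))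
            - ((s + r : ℕ) : ℝ) ^ 2 * C * Real.exp (-(c * n * ε ^ 2 / M.ζerr)))
          (fun ω => M.ForEstimates lam ω fun B =>
            B.Nonempty ∧ ∀ b ∈ B,
              l2Norm (b - M.β) ≤ C * lam * Real.sqrt s / M.RE ∧
              l1Norm (b - M.β) ≤ C * lam * s / M.RE)) ∧
      -- support recovery under the irrepresentable and minimum eigenvalue conditions
      (∃ ε₁ ε₂ ε₃ : (s : ℕ) → Matrix (Fin s) (Fin s) ℝ → (Fin s → ℝ) → ℝ → ℝ → ℝ → ℝ,
        (∀ s K β γ τ σ, 0 < ε₁ s K β γ τ σ ∧ 0 < ε₂ s K β γ τ σ ∧ 0 < ε₃ s K β γ τ σ) ∧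
        ∀ (n s r : ℕ) (Ω : Type*) [MeasurableSpace Ω] (M : AdditiveModel n s r Ω) (lam ε : ℝ),
          0 < M.γ → 0 < M.Cmin →
          0 < lam → lam ≤ min (c * M.τ ^ 2) (4 * (c * M.τ ^ 2) / M.γ) →
          0 < ε →
          ε ≤ min (ε₁ s M.gramSS M.βS M.γ M.τ M.σ)
            (lam / (lam * ε₂ s M.gramSS M.βS M.γ M.τ M.σ + ε₃ s M.gramSS M.βS M.γ M.τ M.σ)) →
          HoldsWithProb M.P
            (1 - (((s + r : ℕ) : ℝ) ^ 2 * C *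
                  Real.exp (-(c * n * M.γ ^ 2 * lam ^ 2 / (s ^ 2 * M.ζsign)))
              + ((s + r : ℕ) : ℝ) ^ 2 * C * Real.exp (-(c * n * ε ^ 2 / (s ^ 2 * M.ζsign)))))
            (fun ω => M.ForEstimates lam ω fun B =>
              ∃ b, B = {b} ∧
                (∀ j, b (Sum.inr j) = 0) ∧
                (∀ j, |b (Sum.inl j) - M.βS j| ≤ M.κ * lam) ∧
                (M.κ * lam ≤ M.βmin →
                  ∀ j, SignType.sign (b (Sum.inl j)) = SignType.sign (M.βS j))))) ∧
    -- sign consistency and the sup norm bound along a sequence of models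
    (∀ (n s r : ℕ → ℕ) (Ω : ℕ → Type*) [∀ k, MeasurableSpace (Ω k)]
      (M : ∀ k, AdditiveModel (n k) (s k) (r k) (Ω k)) (lam : ℕ → ℝ),
      (∀ k, 0 < (M k).γ) → (∀ k, 0 < (M k).Cmin) → (∀ k, 0 < lam k) →
      (∃ γ₀ : ℝ, 0 < γ₀ ∧ ∀ᶠ k in atTop, γ₀ ≤ (M k).γ) →
      (fun k => (M k).τ) =O[atTop] (fun _ => (1 : ℝ)) →
      (fun k => (M k).κ) =O[atTop] (fun _ => (1 : ℝ)) →
      Tendsto n atTop atTop → Tendsto (fun k => s k + r k) atTop atTop →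
      Tendsto (fun k => (s k : ℝ) ^ 2 * Real.log ((s k + r k : ℕ) : ℝ) / n k) atTop (𝓝 0) →
      (fun k => s k * Real.sqrt ((M k).ζsign * Real.log ((s k + r k : ℕ) : ℝ) / n k))
        =o[atTop] (fun k => (M k).βmin) →
      lam =o[atTop] (fun k => (M k).βmin) →
      (fun k => s k * Real.sqrt ((M k).ζsign * Real.log ((s k + r k : ℕ) : ℝ) / n k))
        =o[atTop] lam →
      ∃ q : ℕ → ℝ, Tendsto q atTop (𝓝 1) ∧ ∀ k,
        HoldsWithProb (M k).P (q k) (fun ω => (M k).ForEstimates (lam k) ω fun B =>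
          ∃ b, B = {b} ∧
            (∀ j, SignType.sign (b j) = SignType.sign ((M k).β j)) ∧
            (∀ j, |b (Sum.inl j) - (M k).βS j| ≤ (M k).κ * lam k))) := by
  refine ⟨⟨24, 1 / 3538944, by norm_num, by norm_num, ?_, ?_⟩, ?_⟩
  · intro n s r Ω _ M lam ε hRE hlam hlam' hε hε'
    exact M.error_bounds hRE hlam hlam' hε hε'
  · classical
    -- `ε₁` encodes `ε ≤ c τ²` and `32 ε φ ≤ γ`; `ε₃` encodes `32 ε B ≤ γ lam`, the `+ 1` keeping it
    -- positive at `β = 0`. The default 1 serves arguments outside the range of the model, where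
    -- positivity is still demanded.
    refine ⟨fun s K β γ τ σ => if 0 < γ ∧ 0 < τ then
        min (1 / 3538944 * τ ^ 2) (γ / (32 * (linftyNorm K⁻¹ + 1))) else 1,
      fun s K β γ τ σ => 1,
      fun s K β γ τ σ => if 0 < γ then (32 * ‖β‖ + 1) / γ else 1, ?_, ?_⟩
    · intro s K β γ τ σ
      have hK := linftyNorm_nonneg K⁻¹
      refine ⟨?_, one_pos, ?_⟩
      · beta_reduce
        split_ifs with h
        · obtain ⟨h1, h2⟩ := h
          exact lt_min (by positivity) (by positivity)
        · exact one_pos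
      · beta_reduce
        split_ifs with h
        · positivity
        · exact one_pos
    · intro n s r Ω _ M lam ε hγ hC hlam hlam' hε hε'
      have hφ := linftyNorm_nonneg M.gramSS⁻¹
      beta_reduce at hε'
      rw [if_pos ⟨hγ, M.τ_pos⟩, if_pos hγ] at hε'
      obtain ⟨h1, h2⟩ := le_min_iff.1 hε'
      obtain ⟨h3, h4⟩ := le_min_iff.1 h1
      refine M.support_recovery hγ hC hlam (hlam'.trans (min_le_right _ _)) hε h3 ?_ ?_
      · rw [le_div_iff₀ (by positivity)] at h4
        linarith
      · have hB : 0 ≤ M.βmax := norm_nonneg _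
        change ε ≤ lam / (lam * 1 + (32 * M.βmax + 1) / M.γ) at h2
        -- Dropping the `ε₂` term from the denominator leaves `ε (32 B + 1) ≤ γ lam`.
        have h5 : lam / (lam * 1 + (32 * M.βmax + 1) / M.γ) ≤
            lam / ((32 * M.βmax + 1) / M.γ) := by
          gcongr
          linarith
        have h6 := h2.trans h5
        rw [div_div_eq_mul_div, le_div_iff₀ (by positivity)] at h6
        linarith
  · intro n s r Ω _ M lam _ hC hlam hγ hτ hκ _ hp hsn _ hlamβ hζlam
    exact sign_consistency n s r Ω M lam hC hlam hγ hτ hκ hp hsn hlamβ hζlam
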